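/- A \emph{combinatory algebra} is a structure $(C,\cdot,\mathsf k,\mathsf s)$ with a binary operation and two constants such that $\mathsf kxy=x$ and $\mathsf sxyz=xz(yz)$ for all $x,y,z\in C$. It is \emph{directly indecomposable} if it is not isomorphic to the Cartesian product of two combinatory algebras each having at least two elements. Consider the following three Cartesian closed categories. (1) Complete partial orders (with least element and least upper bounds of directed sets) and Scott continuous maps; function spaces are ordered pointwise. (2) dI-domains (bounded complete algebraic complete partial orders in which $x\wedge(y\vee z)=(x\wedge y)\vee(x\wedge z)$ whenever $y,z$ have an upper bound, and in which every compact element has only finitely many elements below it) and stable maps (Scott continuous maps that preserve the meet of every pair having an upper bound); function spaces carry the stable order: $f\le g$ iff $f(x)=f(y)\wedge g(x)$ for all $x\le y$. (3) dI-domains with coherence (dI-domains $E$ with a set $\mathcal C(E)$ of non-empty finite subsets that contains all singletons; contains every non-empty finite $B$ for which there is $A\in\mathcal C(E)$ such that each $b\in B$ is below some $a\in A$ and each $a\in A$ is above some $b\in B$; and contains $\{\bigvee D_1,\dots,\bigvee D_n\}$ whenever $D_1,\dots,D_n$ are directed and $\{x_1,\dots,x_n\}\in\mathcal C(E)$ for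 all $x_i\in D_i$) and strongly stable maps (Scott continuous maps that send coherent sets to coherent sets and preserve their meets). Function spaces $E\Rightarrow E'$ carry the stable order, and a non-empty finite $F$ is coherent iff for all $A\in\mathcal C(E)$ and all $M\subseteq F\times A$ projecting onto $F$ and onto $A$, the set $\{f(a):(f,a)\in M\}$ is coherent with meet $(\bigwedge F)(\bigwedge A)$. A continuous (respectively stable, strongly stable) model of the $\lambda$-calculus is a reflexive object of category (1) (respectively (2), (3)): an object $U$ with morphisms $\mathrm{App}:U\to[U\Rightarrow U]$ and $\mathrm{Abs}:[U\Rightarrow U]\to U$ such that $\mathrm{App}\circ\mathrm{Abs}=\mathrm{id}$. It is a combinatory algebra with $x\cdot y=\mathrm{App}(x)(y)$, $\mathsf k=\lambda xy.x$ and $\mathsf s=\lambda xyz.xz(yz)$, where $\lambda x.f(x)$ stands for $\mathrm{Abs}(f)$. A $\lambda$-theory is a congruence (for application and abstraction) on the set of $\lambda$-terms modulo $\alpha$-equivalence that contains $\beta$-conversion. A $\lambda$-term is solvable if it is $\beta$-convertible to a term $\lambda x_1\dots x_n.yM_1\cdots M_k$ with $n,k\ge 0$ and $y$ a variable (free or bound).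 A $\lambda$-theory is semi-sensible if it never equates a solvable and an unsolvable term. The term model of a $\lambda$-theory $\mathcal T$ is the set of (open) $\lambda$-terms modulo $\mathcal T$ with application, $\mathsf k=[\lambda xy.x]$ and $\mathsf s=[\lambda xyz.xz(yz)]$. Theorem. Every continuous, every stable and every strongly stable model of the $\lambda$-calculus is directly indecomposable as a combinatory algebra. The term model of every semi-sensible $\lambda$-theory is directly indecomposable as a combinatory algebra. -/

import Mathlib

open Set

universe u v w

/-! ## Combinatory algebras and direct indecomposability -/

/-- A combinatory algebra `(C, ·, k, s)`. -/
structure CombinatoryAlgebra : Type (u + 1) where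
  carrier : Type u
  app : carrier → carrier → carrier
  k : carrier
  s : carrier
  k_app : ∀ x y, app (app k x) y = x
  s_app : ∀ x y z, app (app (app s x) y) z = app (app x z) (app y z)

namespace CombinatoryAlgebra

/-- The Cartesian product of two combinatory algebras. -/
def prod (B : CombinatoryAlgebra.{u}) (C : CombinatoryAlgebra.{v}) :
    CombinatoryAlgebra.{max u v} where
  carrier := B.carrier × C.carrier
  app x y := (B.app x.1 y.1, C.app x.2 y.2)
  k := (B.k, C.k)
  s := (B.s, C.s)
  k_app x y := by simp [B.k_app, C.k_app]
  s_app x y z := by simp [B.s_app, C.s_app]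

/-- Isomorphisms of combinatory algebras. -/
structure Iso (A : CombinatoryAlgebra.{u}) (B : CombinatoryAlgebra.{v}) where
  toEquiv : A.carrier ≃ B.carrier
  map_app : ∀ x y, toEquiv (A.app x y) = B.app (toEquiv x) (toEquiv y)
  map_k : toEquiv A.k = B.k
  map_s : toEquiv A.s = B.s

/-- A combinatory algebra is directly indecomposable if it is not isomorphic to the Cartesian
product of two non-trivial combinatory algebras. (Factors of `A` are quotients of `A`, so nothing is
lost by taking them in the universe of `A`.) -/
def DirectlyIndecomposable (A : CombinatoryAlgebra.{u}) : Prop :=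
  ¬ ∃ B C : CombinatoryAlgebra.{u},
    Nontrivial B.carrier ∧ Nontrivial C.carrier ∧ Nonempty (Iso A (B.prod C))

end CombinatoryAlgebra

/-! ## The continuous semantics: complete partial orders and Scott continuous maps -/

/-- Scott continuous maps. -/
structure ScottMap (α : Type u) (β : Type v) [PartialOrder α] [PartialOrder β] where
  toFun : α → β
  scottContinuous : ScottContinuous toFun

namespace ScottMap

instance {α : Type u} {β : Type v} [PartialOrder α] [PartialOrder β] :
    FunLike (ScottMap α β) α β where
  coe := toFun
  coe_injective f g h := by cases f; cases g; congr

/-- The function space is ordered pointwise. -/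
instance {α : Type u} {β : Type v} [PartialOrder α] [PartialOrder β] :
    PartialOrder (ScottMap α β) where
  le f g := ∀ x, f x ≤ g x
  le_refl f x := le_rfl
  le_trans f g h h₁ h₂ x := (h₁ x).trans (h₂ x)
  le_antisymm f g h₁ h₂ := DFunLike.ext f g fun x => (h₁ x).antisymm (h₂ x)

theorem isLUB_apply {α : Type u} {β : Type v} [PartialOrder α] [CompletePartialOrder β]
    {F : Set (ScottMap α β)} (hF : DirectedOn (· ≤ ·) F) {f : ScottMap α β} (hf : IsLUB F f)
    (x : α) : IsLUB ((fun g : ScottMap α β => g x) '' F) (f x) := by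
  have hdir : ∀ x, DirectedOn (· ≤ ·) ((fun g : ScottMap α β => g x) '' F) := by
    rintro x _ ⟨g, hg, rfl⟩ _ ⟨h, hh, rfl⟩
    obtain ⟨l, hl, h₁, h₂⟩ := hF g hg h hh
    exact ⟨l x, ⟨l, hl, rfl⟩, h₁ x, h₂ x⟩
  have hlub := fun x => (hdir x).isLUB_sSup
  have hp : ScottContinuous fun x => sSup ((fun g : ScottMap α β => g x) '' F) := by
    intro d hd hd' a ha
    constructor
    · rintro _ ⟨z, hz, rfl⟩
      refine (hlub z).2 ?_
      rintro _ ⟨g, hg, rfl⟩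
      exact (g.scottContinuous.monotone (ha.1 hz)).trans ((hlub a).1 ⟨g, hg, rfl⟩)
    · intro b hb
      refine (hlub a).2 ?_
      rintro _ ⟨g, hg, rfl⟩
      refine (g.scottContinuous hd hd' ha).2 ?_
      rintro _ ⟨z, hz, rfl⟩
      exact ((hlub z).1 ⟨g, hg, rfl⟩).trans (hb ⟨z, hz, rfl⟩)
  have hp' : IsLUB F (⟨_, hp⟩ : ScottMap α β) :=
    ⟨fun g hg y => (hlub y).1 ⟨g, hg, rfl⟩, fun g hg y => (hlub y).2 (by
      rintro _ ⟨h, hh, rfl⟩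
      exact hg hh y)⟩
  rw [hf.unique hp']
  exact hlub x

/-- Currying. -/
def curry {γ : Type w} {α : Type u} {β : Type v} [PartialOrder γ] [PartialOrder α]
    [PartialOrder β] (h : ScottMap (γ × α) β) : ScottMap γ (ScottMap α β) where
  toFun z := ⟨fun x => h (z, x), fun d hd hd' a ha => by
    have := ((ScottContinuous.prodMk (ScottContinuous.const z) ScottContinuous.id).comp
      h.scottContinuous) hd hd' ha
    exact this⟩
  scottContinuous d hd hd' a ha := by
    have key : ∀ x, IsLUB ((fun z => h (z, x)) '' d) (h (a, x)) := fun x =>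
      ((ScottContinuous.prodMk ScottContinuous.id (ScottContinuous.const x)).comp
        h.scottContinuous) hd hd' ha
    constructor
    · rintro _ ⟨z, hz, rfl⟩ x
      exact (key x).1 ⟨z, hz, rfl⟩
    · intro g hg x
      refine (key x).2 ?_
      rintro _ ⟨z, hz, rfl⟩
      exact hg ⟨z, hz, rfl⟩ x

/-- Uncurrying. -/
def uncurry {γ : Type w} {α : Type u} {β : Type v} [PartialOrder γ] [PartialOrder α]
    [CompletePartialOrder β] (h : ScottMap γ (ScottMap α β)) : ScottMap (γ × α) β where
  toFun p := h p.1 p.2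
  scottContinuous := by
    refine ScottContinuous.fromProd (fun a => (h a).scottContinuous) ?_
    intro x d hd hd' a ha
    have := isLUB_apply (DirectedOn.mono_comp (fun _ _ hab => h.scottContinuous.monotone hab) hd')
      (h.scottContinuous hd hd' ha) x
    rw [image_image] at this
    exact this

/-- Composition. -/
def comp {γ : Type w} {α : Type u} {β : Type v} [PartialOrder γ] [PartialOrder α]
    [PartialOrder β] (g : ScottMap α β) (f : ScottMap γ α) : ScottMap γ β :=
  ⟨fun x => g (f x), f.scottContinuous.comp g.scottContinuous⟩

end ScottMap

/-- A continuous model: a reflexive object `(U, App, Abs)` in the category of complete partial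
orders and Scott continuous maps. -/
structure ContinuousModel : Type (u + 1) where
  U : Type u
  [cpo : CompletePartialOrder U]
  App : ScottMap U (ScottMap U U)
  Abs : ScottMap (ScottMap U U) U
  app_abs : ∀ f, App (Abs f) = f

namespace ContinuousModel

attribute [instance] cpo

variable (D : ContinuousModel.{u})

/-- The map `x ↦ λy.x`. -/
def kMap : ScottMap D.U D.U :=
  D.Abs.comp (ScottMap.curry ⟨Prod.fst, ScottContinuous.fst⟩)

/-- The map `((x, y), z) ↦ xz(yz)`. -/
def sMap₃ : ScottMap ((D.U × D.U) × D.U) D.U where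
  toFun p := D.App (D.App p.1.1 p.2) (D.App p.1.2 p.2)
  scottContinuous := by
    have h := (ScottMap.uncurry D.App).scottContinuous
    have h₁ : ScottContinuous fun p : (D.U × D.U) × D.U => p.1.1 :=
      ScottContinuous.fst.comp ScottContinuous.fst
    have h₂ : ScottContinuous fun p : (D.U × D.U) × D.U => p.1.2 :=
      ScottContinuous.fst.comp ScottContinuous.snd
    have h₃ : ScottContinuous fun p : (D.U × D.U) × D.U => p.2 := ScottContinuous.snd
    exact (((h₁.prodMk h₃).comp h).prodMk ((h₂.prodMk h₃).comp h)).comp h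

/-- The map `x ↦ λyz.xz(yz)`. -/
def sMap : ScottMap D.U D.U :=
  D.Abs.comp (ScottMap.curry (D.Abs.comp (ScottMap.curry D.sMap₃)))

/-- The combinatory algebra underlying the `λ`-model of the points of `U`:
`x · y = App(x)(y)`, `k = λxy.x` and `s = λxyz.xz(yz)`. -/
def toCombinatoryAlgebra : CombinatoryAlgebra.{u} where
  carrier := D.U
  app x y := D.App x y
  k := D.Abs D.kMap
  s := D.Abs D.sMap
  k_app x y := by
    rw [D.app_abs]
    change D.App (D.Abs _) y = x
    rw [D.app_abs]
    rfl
  s_app x y z := by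
    rw [D.app_abs]
    change D.App (D.App (D.Abs _) y) z = _
    rw [D.app_abs]
    change D.App (D.Abs _) z = _
    rw [D.app_abs]
    rfl

end ContinuousModel

/-! ## The stable semantics: dI-domains and stable maps -/

/-- A dI-domain: a bounded complete algebraic cpo, distributive, in which every compact element has
only finitely many elements below it. Binary meets exist by bounded completeness; they are
recorded as data. -/
class DIDomain (α : Type u) extends CompletePartialOrder α, SemilatticeInf α where
  exists_isLUB : ∀ s : Set α, BddAbove s → ∃ a, IsLUB s a
  directedOn_compact : ∀ x : α, DirectedOn (· ≤ ·) {c : α | IsCompactElement c ∧ c ≤ x}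
  isLUB_compact : ∀ x : α, IsLUB {c : α | IsCompactElement c ∧ c ≤ x} x
  inf_distrib : ∀ x y z j : α, IsLUB {y, z} j → IsLUB {x ⊓ y, x ⊓ z} (x ⊓ j)
  finite_below : ∀ c : α, IsCompactElement c → {x : α | x ≤ c}.Finite

theorem DIDomain.le_of_compact {α : Type u} [DIDomain α] {x y : α}
    (h : ∀ c : α, IsCompactElement c → c ≤ x → c ≤ y) : x ≤ y :=
  (DIDomain.isLUB_compact x).2 fun c hc => h c hc.1 hc.2

theorem exists_le_of_isLUB_image {ι : Type v} {α : Type u} [PartialOrder α] {s : Set ι}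
    {f : ι → α} {a c : α} (hc : IsCompactElement c) (hs : s.Nonempty)
    (hd : DirectedOn (· ≤ ·) (f '' s)) (ha : IsLUB (f '' s) a) (hca : c ≤ a) :
    ∃ i ∈ s, c ≤ f i := by
  obtain ⟨_, ⟨i, hi, rfl⟩, h⟩ := hc _ _ (hs.image f) hd ha hca
  exact ⟨i, hi, h⟩

/-- A map is stable if it is Scott continuous and preserves the meets of compatible pairs. -/
structure IsStable {α : Type u} {β : Type v} [PartialOrder α] [PartialOrder β] (f : α → β) :
    Prop where
  scottContinuous : ScottContinuous f
  map_isGLB : ∀ x y m, BddAbove {x, y} → IsGLB {x, y} m → IsGLB {f x, f y} (f m)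

/-- Stable maps. -/
structure StableMap (α : Type u) (β : Type v) [PartialOrder α] [PartialOrder β] where
  toFun : α → β
  isStable : IsStable toFun

namespace IsStable

variable {α : Type u} {β : Type v} {γ : Type w} [PartialOrder α] [PartialOrder β] [PartialOrder γ]

theorem monotone {f : α → β} (hf : IsStable f) : Monotone f := hf.scottContinuous.monotone

theorem comp {g : β → γ} {f : α → β} (hg : IsStable g) (hf : IsStable f) :
    IsStable fun x => g (f x) where
  scottContinuous := hf.scottContinuous.comp hg.scottContinuous
  map_isGLB x y m hb hm := by
    refine hg.map_isGLB _ _ _ ?_ (hf.map_isGLB x y m hb hm)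
    have := hf.monotone.map_bddAbove hb
    rwa [image_pair] at this

theorem fst : IsStable (Prod.fst : α × β → α) where
  scottContinuous := ScottContinuous.fst
  map_isGLB x y m _ hm := by
    have := (isGLB_prod.1 hm).1
    rwa [image_pair] at this

theorem snd : IsStable (Prod.snd : α × β → β) where
  scottContinuous := ScottContinuous.snd
  map_isGLB x y m _ hm := by
    have := (isGLB_prod.1 hm).2
    rwa [image_pair] at this

theorem prodMk {f : γ → α} {g : γ → β} (hf : IsStable f) (hg : IsStable g) :
    IsStable fun x => (f x, g x) where
  scottContinuous := hf.scottContinuous.prodMk hg.scottContinuous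
  map_isGLB x y m hb hm := by
    refine isGLB_prod.2 ⟨?_, ?_⟩
    · rw [image_pair]
      exact hf.map_isGLB x y m hb hm
    · rw [image_pair]
      exact hg.map_isGLB x y m hb hm

theorem const (a : β) : IsStable fun _ : α => a where
  scottContinuous := ScottContinuous.const a
  map_isGLB x y m _ _ := by simp

theorem id : IsStable fun x : α => x where
  scottContinuous := ScottContinuous.id
  map_isGLB _ _ _ _ hm := hm

end IsStable

namespace StableMap

instance {α : Type u} {β : Type v} [PartialOrder α] [PartialOrder β] :
    FunLike (StableMap α β) α β where
  coe := toFun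
  coe_injective f g h := by cases f; cases g; congr

/-- The function space carries the stable (Berry) order: `f ≤ g` if and only if
`f x = f y ⊓ g x` for all `x ≤ y`. -/
instance {α : Type u} {β : Type v} [PartialOrder α] [SemilatticeInf β] :
    PartialOrder (StableMap α β) where
  le f g := ∀ x y, x ≤ y → f x = f y ⊓ g x
  le_refl f x y h := (inf_eq_right.2 (f.isStable.monotone h)).symm
  le_trans f g h h₁ h₂ x y hxy := by
    have hfg : f y ≤ g y := (h₁ y y le_rfl).le.trans inf_le_right
    rw [h₁ x y hxy, h₂ x y hxy, ← inf_assoc, inf_eq_left.2 hfg]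
  le_antisymm f g h₁ h₂ := DFunLike.ext f g fun x => by
    rw [h₁ x x le_rfl, inf_comm, ← h₂ x x le_rfl]

theorem apply_le {α : Type u} {β : Type v} [PartialOrder α] [SemilatticeInf β]
    {f g : StableMap α β} (h : f ≤ g) (x : α) : f x ≤ g x :=
  inf_eq_left.1 (h x x le_rfl).symm

theorem isLUB_apply {α : Type u} {β : Type v} [PartialOrder α] [DIDomain β]
    {F : Set (StableMap α β)} (hne : F.Nonempty) (hF : DirectedOn (· ≤ ·) F)
    {f : StableMap α β} (hf : IsLUB F f) (x : α) :
    IsLUB ((fun g : StableMap α β => g x) '' F) (f x) := by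
  have hdir : ∀ x, DirectedOn (· ≤ ·) ((fun g : StableMap α β => g x) '' F) := fun x =>
    DirectedOn.mono_comp (fun _ _ h => apply_le h x) hF
  have hlub := fun x => (hdir x).isLUB_sSup
  have hcpt : ∀ x c, IsCompactElement c → c ≤ sSup ((fun g : StableMap α β => g x) '' F) →
      ∃ g ∈ F, c ≤ g x := fun x c hc h => exists_le_of_isLUB_image hc hne (hdir x) (hlub x) h
  have hmono : Monotone fun x => sSup ((fun g : StableMap α β => g x) '' F) := by
    intro y z hyz
    refine (hlub y).2 ?_
    rintro _ ⟨g, hg, rfl⟩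
    exact (g.isStable.monotone hyz).trans ((hlub z).1 ⟨g, hg, rfl⟩)
  have hp : IsStable fun x => sSup ((fun g : StableMap α β => g x) '' F) := by
    refine ⟨fun d hd hd' a ha => ⟨?_, fun b hb => ?_⟩, fun y z m hb hm => ⟨?_, fun b hb => ?_⟩⟩
    · rintro _ ⟨z, hz, rfl⟩
      exact hmono (ha.1 hz)
    · refine (hlub a).2 ?_
      rintro _ ⟨g, hg, rfl⟩
      refine (g.isStable.scottContinuous hd hd' ha).2 ?_
      rintro _ ⟨z, hz, rfl⟩
      exact ((hlub z).1 ⟨g, hg, rfl⟩).trans (hb ⟨z, hz, rfl⟩)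
    · rintro _ (rfl | rfl)
      · exact hmono (hm.1 (by simp))
      · exact hmono (hm.1 (by simp))
    · refine DIDomain.le_of_compact fun c hc hcb => ?_
      obtain ⟨g, hg, hcg⟩ := hcpt y c hc (hcb.trans (hb (by simp)))
      obtain ⟨h, hh, hch⟩ := hcpt z c hc (hcb.trans (hb (by simp)))
      obtain ⟨l, hl, hgl, hhl⟩ := hF g hg h hh
      refine le_trans ?_ ((hlub m).1 ⟨l, hl, rfl⟩)
      refine (l.isStable.map_isGLB y z m ‹_› hm).2 ?_
      rintro _ (rfl | rfl)
      · exact hcg.trans (apply_le hgl _)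
      · exact hch.trans (apply_le hhl _)
  have hp' : IsLUB F (⟨_, hp⟩ : StableMap α β) := by
    constructor
    · intro g hg y z hyz
      refine le_antisymm (le_inf (g.isStable.monotone hyz) ((hlub y).1 ⟨g, hg, rfl⟩)) ?_
      refine DIDomain.le_of_compact fun c hc hcb => ?_
      obtain ⟨h, hh, hch⟩ := hcpt y c hc (hcb.trans inf_le_right)
      obtain ⟨l, hl, hgl, hhl⟩ := hF g hg h hh
      rw [hgl y z hyz]
      exact le_inf (hcb.trans inf_le_left) (hch.trans (apply_le hhl _))
    · intro g hg y z hyz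
      refine le_antisymm (le_inf (hmono hyz) ((hlub y).2 ?_)) ?_
      · rintro _ ⟨h, hh, rfl⟩
        exact apply_le (hg hh) y
      · refine DIDomain.le_of_compact fun c hc hcb => ?_
        obtain ⟨h, hh, hch⟩ := hcpt z c hc (hcb.trans inf_le_left)
        refine le_trans ?_ ((hlub y).1 ⟨h, hh, rfl⟩)
        change c ≤ h y
        rw [hg hh y z hyz]
        exact le_inf hch (hcb.trans inf_le_right)
  rw [hf.unique hp']
  exact hlub x

theorem isGLB_apply {α : Type u} {β : Type v} [PartialOrder α] [DIDomain β]
    {f₁ f₂ f : StableMap α β} (hb : BddAbove {f₁, f₂}) (hf : IsGLB {f₁, f₂} f) (x : α) :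
    f x = f₁ x ⊓ f₂ x := by
  obtain ⟨g, hg⟩ := hb
  have hg₁ : f₁ ≤ g := hg (by simp)
  have hg₂ : f₂ ≤ g := hg (by simp)
  have hq : IsStable fun x => f₁ x ⊓ f₂ x := by
    have hmono : Monotone fun x => f₁ x ⊓ f₂ x := fun y z h =>
      inf_le_inf (f₁.isStable.monotone h) (f₂.isStable.monotone h)
    refine ⟨fun d hd hd' a ha => ⟨?_, fun b hb => ?_⟩, fun y z m hb hm => ?_⟩
    · rintro _ ⟨z, hz, rfl⟩
      exact hmono (ha.1 hz)
    · refine DIDomain.le_of_compact fun c hc hcb => ?_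
      obtain ⟨y, hy, hcy⟩ := exists_le_of_isLUB_image hc hd
        (DirectedOn.mono_comp (fun _ _ h => f₁.isStable.monotone h) hd')
        (f₁.isStable.scottContinuous hd hd' ha) (hcb.trans inf_le_left)
      obtain ⟨z, hz, hcz⟩ := exists_le_of_isLUB_image hc hd
        (DirectedOn.mono_comp (fun _ _ h => f₂.isStable.monotone h) hd')
        (f₂.isStable.scottContinuous hd hd' ha) (hcb.trans inf_le_right)
      obtain ⟨w, hw, hyw, hzw⟩ := hd' y hy z hz
      exact (le_inf (hcy.trans (f₁.isStable.monotone hyw))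
        (hcz.trans (f₂.isStable.monotone hzw))).trans (hb ⟨w, hw, rfl⟩)
    · have h₁ := (f₁.isStable.map_isGLB y z m hb hm).unique isGLB_pair
      have h₂ := (f₂.isStable.map_isGLB y z m hb hm).unique isGLB_pair
      change IsGLB _ (f₁.toFun m ⊓ f₂.toFun m)
      rw [h₁, h₂, inf_inf_inf_comm]
      exact isGLB_pair
  have key : ∀ {y z}, y ≤ z → f₁ y ⊓ f₂ y = (f₁ z ⊓ f₂ z) ⊓ f₁ y ∧
      f₁ y ⊓ f₂ y = (f₁ z ⊓ f₂ z) ⊓ f₂ y := by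
    intro y z hyz
    have hm := inf_le_inf (f₁.isStable.monotone hyz) (f₂.isStable.monotone hyz)
    constructor
    · refine le_antisymm (le_inf hm inf_le_left) (le_inf inf_le_right ?_)
      rw [hg₂ y z hyz]
      exact le_inf (inf_le_left.trans inf_le_right) (inf_le_right.trans (apply_le hg₁ y))
    · refine le_antisymm (le_inf hm inf_le_right) (le_inf ?_ inf_le_right)
      rw [hg₁ y z hyz]
      exact le_inf (inf_le_left.trans inf_le_left) (inf_le_right.trans (apply_le hg₂ y))
  have hq' : IsGLB {f₁, f₂} (⟨_, hq⟩ : StableMap α β) := by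
    constructor
    · rintro _ (rfl | rfl) y z hyz
      · exact (key hyz).1
      · exact (key hyz).2
    · intro r hr y z hyz
      have hr₁ := hr (show f₁ ∈ ({f₁, f₂} : Set _) by simp) y z hyz
      have hr₂ := hr (show f₂ ∈ ({f₁, f₂} : Set _) by simp) y z hyz
      change r y = r z ⊓ (f₁ y ⊓ f₂ y)
      rw [← inf_assoc, ← hr₁, hr₂, inf_assoc, inf_idem]
  rw [hf.unique hq']
  rfl

/-- Currying. -/
def curry {γ : Type w} {α : Type u} {β : Type v} [PartialOrder γ] [PartialOrder α]
    [DIDomain β] (h : StableMap (γ × α) β) : StableMap γ (StableMap α β) where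
  toFun z := ⟨fun x => h (z, x), h.isStable.comp ((IsStable.const z).prodMk IsStable.id)⟩
  isStable := by
    have hx : ∀ x, IsStable fun z => h (z, x) := fun x =>
      h.isStable.comp (IsStable.id.prodMk (IsStable.const x))
    have hmono : ∀ z z' : γ, z ≤ z' → ∀ x y, x ≤ y → h (z, x) = h (z, y) ⊓ h (z', x) := by
      intro z z' hz x y hxy
      refine (h.isStable.map_isGLB (z, y) (z', x) (z, x) ⟨(z', y), ?_⟩ ?_).unique isGLB_pair
      · rintro _ (rfl | rfl)
        · exact ⟨hz, le_rfl⟩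
        · exact ⟨le_rfl, hxy⟩
      · constructor
        · rintro _ (rfl | rfl)
          · exact ⟨le_rfl, hxy⟩
          · exact ⟨hz, le_rfl⟩
        · intro p hp
          exact ⟨(hp (show (z, y) ∈ _ by simp)).1, (hp (show (z', x) ∈ _ by simp)).2⟩
    refine ⟨fun d hd hd' a ha => ⟨?_, fun g hg x y hxy => ?_⟩, fun z z' m hb hm => ⟨?_, ?_⟩⟩
    · rintro _ ⟨z, hz, rfl⟩
      exact hmono z a (ha.1 hz)
    · have ub : ∀ z ∈ d, ∀ x y, x ≤ y → h (z, x) = h (z, y) ⊓ g x := fun z hz =>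
        hg ⟨z, hz, rfl⟩
      change h (a, x) = h (a, y) ⊓ g x
      refine le_antisymm (le_inf (h.isStable.monotone ⟨le_rfl, hxy⟩)
        (((hx x).scottContinuous hd hd' ha).2 ?_)) ?_
      · rintro _ ⟨z, hz, rfl⟩
        exact (ub z hz x x le_rfl).le.trans inf_le_right
      · refine DIDomain.le_of_compact fun c hc hcb => ?_
        obtain ⟨z, hz, hcz⟩ := exists_le_of_isLUB_image hc hd
          (DirectedOn.mono_comp (fun _ _ h => (hx y).monotone h) hd')
          ((hx y).scottContinuous hd hd' ha) (hcb.trans inf_le_left)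
        refine le_trans ?_ ((hx x).monotone (ha.1 hz))
        rw [ub z hz x y hxy]
        exact le_inf hcz (hcb.trans inf_le_right)
    · rintro _ (rfl | rfl)
      · exact hmono m _ (hm.1 (by simp))
      · exact hmono m _ (hm.1 (by simp))
    · intro r hr x y hxy
      have hr₁ : r x = r y ⊓ h (z, x) := hr (mem_insert _ _) x y hxy
      have hr₂ : r x = r y ⊓ h (z', x) := hr (mem_insert_of_mem _ rfl) x y hxy
      have hm' : h (m, x) = h (z, x) ⊓ h (z', x) :=
        ((hx x).map_isGLB z z' m hb hm).unique isGLB_pair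
      change r x = r y ⊓ h (m, x)
      rw [hm', ← inf_assoc, ← hr₁, hr₂, inf_assoc, inf_idem]

/-- Uncurrying. -/
def uncurry {γ : Type w} {α : Type u} {β : Type v} [SemilatticeInf γ] [SemilatticeInf α]
    [DIDomain β] (h : StableMap γ (StableMap α β)) : StableMap (γ × α) β where
  toFun p := h p.1 p.2
  isStable := by
    refine ⟨?_, ?_⟩
    · refine ScottContinuous.fromProd (fun a => (h a).isStable.scottContinuous) ?_
      intro x d hd hd' a ha
      have := isLUB_apply (hd.image h)
        (DirectedOn.mono_comp (fun _ _ hab => h.isStable.monotone hab) hd')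
        (h.isStable.scottContinuous hd hd' ha) x
      rw [image_image] at this
      exact this
    · rintro ⟨x, y⟩ ⟨x', y'⟩ m ⟨⟨u, v⟩, huv⟩ hm
      obtain ⟨hxu, hyv⟩ : x ≤ u ∧ y ≤ v := huv (mem_insert _ _)
      obtain ⟨hxu', hyv'⟩ : x' ≤ u ∧ y' ≤ v := huv (mem_insert_of_mem _ rfl)
      have hbx : BddAbove {x, x'} := ⟨u, by rintro _ (rfl | rfl) <;> assumption⟩
      have hby : BddAbove {y, y'} := ⟨v, by rintro _ (rfl | rfl) <;> assumption⟩
      have hm₁ : IsGLB {x, x'} m.1 := by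
        have := (isGLB_prod.1 hm).1
        rwa [image_pair] at this
      have hm₂ : IsGLB {y, y'} m.2 := by
        have := (isGLB_prod.1 hm).2
        rwa [image_pair] at this
      have hbf : BddAbove {h x, h x'} := by
        have := h.isStable.monotone.map_bddAbove hbx
        rwa [image_pair] at this
      have e₁ := isGLB_apply hbf (h.isStable.map_isGLB x x' m.1 hbx hm₁) m.2
      have e₂ : (h x) m.2 = h x y ⊓ h x y' :=
        ((h x).isStable.map_isGLB y y' m.2 hby hm₂).unique isGLB_pair
      have e₃ : (h x') m.2 = h x' y ⊓ h x' y' :=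
        ((h x').isStable.map_isGLB y y' m.2 hby hm₂).unique isGLB_pair
      have hle : h x ≤ h u := h.isStable.monotone hxu
      have hle' : h x' ≤ h u := h.isStable.monotone hxu'
      have l₁ : h x y ⊓ h x' y' ≤ h x y' := by
        rw [hle y' v hyv']
        exact inf_le_inf ((h x).isStable.monotone hyv) (apply_le hle' y')
      have l₂ : h x y ⊓ h x' y' ≤ h x' y := by
        rw [hle' y v hyv, inf_comm]
        exact inf_le_inf ((h x').isStable.monotone hyv') (apply_le hle y)
      have : h m.1 m.2 = h x y ⊓ h x' y' := by
        refine le_antisymm ?_ ?_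
        · refine e₁.le.trans ?_
          rw [e₂, e₃]
          exact inf_le_inf inf_le_left inf_le_right
        · refine le_trans ?_ e₁.ge
          rw [e₂, e₃]
          exact le_inf (le_inf inf_le_left l₁) (le_inf l₂ inf_le_right)
      rw [this]
      exact isGLB_pair

/-- Composition. -/
def comp {γ : Type w} {α : Type u} {β : Type v} [PartialOrder γ] [PartialOrder α]
    [PartialOrder β] (g : StableMap α β) (f : StableMap γ α) : StableMap γ β :=
  ⟨fun x => g (f x), g.isStable.comp f.isStable⟩

end StableMap

/-- A stable model: a reflexive object `(U, App, Abs)` in the category of dI-domains and stable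
maps. -/
structure StableModel : Type (u + 1) where
  U : Type u
  [dom : DIDomain U]
  App : StableMap U (StableMap U U)
  Abs : StableMap (StableMap U U) U
  app_abs : ∀ f, App (Abs f) = f

namespace StableModel

attribute [instance] dom

variable (D : StableModel.{u})

/-- The map `x ↦ λy.x`. -/
def kMap : StableMap D.U D.U :=
  D.Abs.comp (StableMap.curry ⟨Prod.fst, IsStable.fst⟩)

/-- The map `((x, y), z) ↦ xz(yz)`. -/
def sMap₃ : StableMap ((D.U × D.U) × D.U) D.U where
  toFun p := D.App (D.App p.1.1 p.2) (D.App p.1.2 p.2)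
  isStable := by
    have h := (StableMap.uncurry D.App).isStable
    have h₁ : IsStable fun p : (D.U × D.U) × D.U => p.1.1 := IsStable.fst.comp IsStable.fst
    have h₂ : IsStable fun p : (D.U × D.U) × D.U => p.1.2 := IsStable.snd.comp IsStable.fst
    have h₃ : IsStable fun p : (D.U × D.U) × D.U => p.2 := IsStable.snd
    exact h.comp ((h.comp (h₁.prodMk h₃)).prodMk (h.comp (h₂.prodMk h₃)))

/-- The map `x ↦ λyz.xz(yz)`. -/
def sMap : StableMap D.U D.U :=
  D.Abs.comp (StableMap.curry (D.Abs.comp (StableMap.curry D.sMap₃)))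

/-- The combinatory algebra underlying the `λ`-model of the points of `U`:
`x · y = App(x)(y)`, `k = λxy.x` and `s = λxyz.xz(yz)`. -/
def toCombinatoryAlgebra : CombinatoryAlgebra.{u} where
  carrier := D.U
  app x y := D.App x y
  k := D.Abs D.kMap
  s := D.Abs D.sMap
  k_app x y := by
    rw [D.app_abs]
    change D.App (D.Abs _) y = x
    rw [D.app_abs]
    rfl
  s_app x y z := by
    rw [D.app_abs]
    change D.App (D.App (D.Abs _) y) z = _
    rw [D.app_abs]
    change D.App (D.Abs _) z = _
    rw [D.app_abs]
    rfl

end StableModel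

/-! ## The strongly stable semantics: dI-domains with coherence and strongly stable maps -/

/-- A distinguished family of subsets, called coherent. -/
class HasCoherence (α : Type u) where
  coh : Set (Set α)

open HasCoherence

/-- A dI-domain with coherence: a dI-domain with a family of non-empty finite subsets which contains
the singletons, is closed downwards for the Egli-Milner preorder, and is closed under least upper
bounds of directed sets. -/
class CoherentDIDomain (α : Type u) extends DIDomain α, HasCoherence α where
  finite_of_coh : ∀ A ∈ coh, A.Finite
  nonempty_of_coh : ∀ A ∈ coh, A.Nonempty
  singleton_coh : ∀ x : α, {x} ∈ coh
  coh_of_egliMilner : ∀ A ∈ coh, ∀ B : Set α, B.Finite → B.Nonempty →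
    (∀ b ∈ B, ∃ a ∈ A, b ≤ a) → (∀ a ∈ A, ∃ b ∈ B, b ≤ a) → B ∈ coh
  coh_of_directed : ∀ (n : ℕ) (D : Fin n → Set α) (d : Fin n → α),
    (∀ i, (D i).Nonempty ∧ DirectedOn (· ≤ ·) (D i) ∧ IsLUB (D i) (d i)) →
    (∀ x : Fin n → α, (∀ i, x i ∈ D i) → range x ∈ coh) → range d ∈ coh

/-- A map is strongly stable if it is Scott continuous, preserves coherence, and preserves the meets
of coherent sets. -/
structure IsStronglyStable {α : Type u} {β : Type v} [PartialOrder α] [PartialOrder β]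
    [HasCoherence α] [HasCoherence β] (f : α → β) : Prop where
  scottContinuous : ScottContinuous f
  map_coh : ∀ A ∈ coh (α := α), f '' A ∈ coh (α := β)
  map_isGLB : ∀ A ∈ coh (α := α), ∀ m, IsGLB A m → IsGLB (f '' A) (f m)

/-- Strongly stable maps. -/
structure StronglyStableMap (α : Type u) (β : Type v) [PartialOrder α] [PartialOrder β]
    [HasCoherence α] [HasCoherence β] where
  toFun : α → β
  isStronglyStable : IsStronglyStable toFun

/-- The coherence of a product: both projections are coherent. -/
instance {α : Type u} {β : Type v} [HasCoherence α] [HasCoherence β] : HasCoherence (α × β) where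
  coh := {A | Prod.fst '' A ∈ coh ∧ Prod.snd '' A ∈ coh}

namespace IsStronglyStable

variable {α : Type u} {β : Type v} {γ : Type w} [PartialOrder α] [PartialOrder β] [PartialOrder γ]
  [HasCoherence α] [HasCoherence β] [HasCoherence γ]

theorem monotone {f : α → β} (hf : IsStronglyStable f) : Monotone f :=
  hf.scottContinuous.monotone

theorem comp {g : β → γ} {f : α → β} (hg : IsStronglyStable g) (hf : IsStronglyStable f) :
    IsStronglyStable fun x => g (f x) where
  scottContinuous := hf.scottContinuous.comp hg.scottContinuous
  map_coh A hA := by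
    have := hg.map_coh _ (hf.map_coh A hA)
    rwa [image_image] at this
  map_isGLB A hA m hm := by
    have := hg.map_isGLB _ (hf.map_coh A hA) _ (hf.map_isGLB A hA m hm)
    rwa [image_image] at this

theorem fst : IsStronglyStable (Prod.fst : α × β → α) where
  scottContinuous := ScottContinuous.fst
  map_coh _ hA := hA.1
  map_isGLB _ _ _ hm := (isGLB_prod.1 hm).1

theorem snd : IsStronglyStable (Prod.snd : α × β → β) where
  scottContinuous := ScottContinuous.snd
  map_coh _ hA := hA.2
  map_isGLB _ _ _ hm := (isGLB_prod.1 hm).2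

theorem prodMk {f : γ → α} {g : γ → β} (hf : IsStronglyStable f) (hg : IsStronglyStable g) :
    IsStronglyStable fun x => (f x, g x) where
  scottContinuous := hf.scottContinuous.prodMk hg.scottContinuous
  map_coh A hA := by
    refine ⟨?_, ?_⟩
    · rw [image_image]
      exact hf.map_coh A hA
    · rw [image_image]
      exact hg.map_coh A hA
  map_isGLB A hA m hm := by
    refine isGLB_prod.2 ⟨?_, ?_⟩
    · rw [image_image]
      exact hf.map_isGLB A hA m hm
    · rw [image_image]
      exact hg.map_isGLB A hA m hm

end IsStronglyStable

namespace StronglyStableMap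

instance {α : Type u} {β : Type v} [PartialOrder α] [PartialOrder β] [HasCoherence α]
    [HasCoherence β] : FunLike (StronglyStableMap α β) α β where
  coe := toFun
  coe_injective f g h := by cases f; cases g; congr

/-- The function space carries the stable (Berry) order: `f ≤ g` if and only if
`f x = f y ⊓ g x` for all `x ≤ y`. -/
instance {α : Type u} {β : Type v} [PartialOrder α] [SemilatticeInf β] [HasCoherence α]
    [HasCoherence β] : PartialOrder (StronglyStableMap α β) where
  le f g := ∀ x y, x ≤ y → f x = f y ⊓ g x
  le_refl f x y h := (inf_eq_right.2 (f.isStronglyStable.monotone h)).symm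
  le_trans f g h h₁ h₂ x y hxy := by
    have hfg : f y ≤ g y := (h₁ y y le_rfl).le.trans inf_le_right
    rw [h₁ x y hxy, h₂ x y hxy, ← inf_assoc, inf_eq_left.2 hfg]
  le_antisymm f g h₁ h₂ := DFunLike.ext f g fun x => by
    rw [h₁ x x le_rfl, inf_comm, ← h₂ x x le_rfl]

/-- The coherence of the function space: a non-empty finite set `F` of maps, with meet `g`, is
coherent if for every coherent set `A` and every `M ⊆ F × A` that projects onto `F` and onto `A`,
the set of the values `f a`, `(f, a) ∈ M`, is coherent and its meet is `g (⋀ A)`. -/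
instance {α : Type u} {β : Type v} [PartialOrder α] [SemilatticeInf β] [HasCoherence α]
    [HasCoherence β] : HasCoherence (StronglyStableMap α β) where
  coh := {F | F.Finite ∧ F.Nonempty ∧ ∃ g, IsGLB F g ∧
    ∀ A ∈ coh (α := α), ∀ M : Set (StronglyStableMap α β × α),
      Prod.fst '' M = F → Prod.snd '' M = A →
        (fun p => p.1 p.2) '' M ∈ coh (α := β) ∧
        ∀ a, IsGLB A a → IsGLB ((fun p => p.1 p.2) '' M) (g a)}

theorem apply_le {α : Type u} {β : Type v} [PartialOrder α] [SemilatticeInf β] [HasCoherence α]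
    [HasCoherence β] {f g : StronglyStableMap α β} (h : f ≤ g) (x : α) : f x ≤ g x :=
  inf_eq_left.1 (h x x le_rfl).symm

theorem exists_upper_of_finite {ι : Type w} {α : Type u} [PartialOrder α] {F : Set α}
    (hne : F.Nonempty) (hF : DirectedOn (· ≤ ·) F) {s : Set ι} (hs : s.Finite) (φ : ι → α)
    (hφ : ∀ i ∈ s, φ i ∈ F) : ∃ g ∈ F, ∀ i ∈ s, φ i ≤ g := by
  induction s, hs using Set.Finite.induction_on with
  | empty => exact ⟨hne.some, hne.some_mem, by simp⟩
  | insert _ _ ih =>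
    obtain ⟨g, hg, h⟩ := ih fun i hi => hφ i (mem_insert_of_mem _ hi)
    obtain ⟨l, hl, h₁, h₂⟩ := hF _ (hφ _ (mem_insert _ _)) g hg
    refine ⟨l, hl, ?_⟩
    rintro i (rfl | hi)
    · exact h₁
    · exact (h i hi).trans h₂

theorem isLUB_apply {α : Type u} {β : Type v} [CoherentDIDomain α] [CoherentDIDomain β]
    {F : Set (StronglyStableMap α β)} (hne : F.Nonempty) (hF : DirectedOn (· ≤ ·) F)
    {f : StronglyStableMap α β} (hf : IsLUB F f) (x : α) :
    IsLUB ((fun g : StronglyStableMap α β => g x) '' F) (f x) := by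
  have hdir : ∀ x, DirectedOn (· ≤ ·) ((fun g : StronglyStableMap α β => g x) '' F) := fun x =>
    DirectedOn.mono_comp (fun _ _ h => apply_le h x) hF
  have hlub := fun x => (hdir x).isLUB_sSup
  have hcpt : ∀ x c, IsCompactElement c →
      c ≤ sSup ((fun g : StronglyStableMap α β => g x) '' F) → ∃ g ∈ F, c ≤ g x :=
    fun x c hc h => exists_le_of_isLUB_image hc hne (hdir x) (hlub x) h
  have hmono : Monotone fun x => sSup ((fun g : StronglyStableMap α β => g x) '' F) := by
    intro y z hyz
    refine (hlub y).2 ?_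
    rintro _ ⟨g, hg, rfl⟩
    exact (g.isStronglyStable.monotone hyz).trans ((hlub z).1 ⟨g, hg, rfl⟩)
  have hp : IsStronglyStable fun x => sSup ((fun g : StronglyStableMap α β => g x) '' F) := by
    refine ⟨fun d hd hd' a ha => ⟨?_, fun b hb => ?_⟩, fun A hA => ?_,
      fun A hA m hm => ⟨?_, fun b hb => ?_⟩⟩
    · rintro _ ⟨z, hz, rfl⟩
      exact hmono (ha.1 hz)
    · refine (hlub a).2 ?_
      rintro _ ⟨g, hg, rfl⟩
      refine (g.isStronglyStable.scottContinuous hd hd' ha).2 ?_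
      rintro _ ⟨z, hz, rfl⟩
      exact ((hlub z).1 ⟨g, hg, rfl⟩).trans (hb ⟨z, hz, rfl⟩)
    · have hfin := CoherentDIDomain.finite_of_coh A hA
      obtain ⟨n, a, rfl⟩ : ∃ (n : ℕ) (a : Fin n → α), A = range a := by
        obtain ⟨n, a, -, ha⟩ := hfin.fin_param
        exact ⟨n, a, ha.symm⟩
      rw [← range_comp]
      have : Nonempty (Fin n) := range_nonempty_iff_nonempty.1
        (CoherentDIDomain.nonempty_of_coh _ hA)
      refine CoherentDIDomain.coh_of_directed n
        (fun i => (fun g : StronglyStableMap α β => g (a i)) '' F) _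
        (fun i => ⟨hne.image _, hdir _, hlub _⟩) ?_
      intro y hy
      choose φ hφ hφy using hy
      obtain ⟨g, hg, hle⟩ := exists_upper_of_finite hne hF (finite_univ (α := Fin n)) φ
        fun i _ => hφ i
      have hyg : ∀ i, y i ≤ g (a i) := fun i =>
        (hφy i).ge.trans (apply_le (hle i (mem_univ i)) _)
      refine CoherentDIDomain.coh_of_egliMilner _ (g.isStronglyStable.map_coh _ hA) _
        (finite_range y) (range_nonempty y) ?_ ?_
      · rintro _ ⟨i, rfl⟩
        exact ⟨_, ⟨a i, ⟨i, rfl⟩, rfl⟩, hyg i⟩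
      · rintro _ ⟨_, ⟨i, rfl⟩, rfl⟩
        exact ⟨_, ⟨i, rfl⟩, hyg i⟩
    · rintro _ ⟨z, hz, rfl⟩
      exact hmono (hm.1 hz)
    · refine DIDomain.le_of_compact fun c hc hcb => ?_
      have hex : ∀ z : α, ∃ g : StronglyStableMap α β, z ∈ A → g ∈ F ∧ c ≤ g z := by
        intro z
        by_cases hz : z ∈ A
        · obtain ⟨g, hg, hcg⟩ := hcpt z c hc (hcb.trans (hb ⟨z, hz, rfl⟩))
          exact ⟨g, fun _ => ⟨hg, hcg⟩⟩
        · exact ⟨hne.some, fun h => absurd h hz⟩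
      choose φ hφ using hex
      obtain ⟨g, hg, hle⟩ := exists_upper_of_finite hne hF
        (CoherentDIDomain.finite_of_coh A hA) φ fun z hz => (hφ z hz).1
      refine le_trans ?_ ((hlub m).1 ⟨g, hg, rfl⟩)
      refine (g.isStronglyStable.map_isGLB A hA m hm).2 ?_
      rintro _ ⟨z, hz, rfl⟩
      exact (hφ z hz).2.trans (apply_le (hle z hz) z)
  have hp' : IsLUB F (⟨_, hp⟩ : StronglyStableMap α β) := by
    constructor
    · intro g hg y z hyz
      refine le_antisymm (le_inf (g.isStronglyStable.monotone hyz) ((hlub y).1 ⟨g, hg, rfl⟩)) ?_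
      refine DIDomain.le_of_compact fun c hc hcb => ?_
      obtain ⟨h, hh, hch⟩ := hcpt y c hc (hcb.trans inf_le_right)
      obtain ⟨l, hl, hgl, hhl⟩ := hF g hg h hh
      rw [hgl y z hyz]
      exact le_inf (hcb.trans inf_le_left) (hch.trans (apply_le hhl _))
    · intro g hg y z hyz
      refine le_antisymm (le_inf (hmono hyz) ((hlub y).2 ?_)) ?_
      · rintro _ ⟨h, hh, rfl⟩
        exact apply_le (hg hh) y
      · refine DIDomain.le_of_compact fun c hc hcb => ?_
        obtain ⟨h, hh, hch⟩ := hcpt z c hc (hcb.trans inf_le_left)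
        refine le_trans ?_ ((hlub y).1 ⟨h, hh, rfl⟩)
        change c ≤ h y
        rw [hg hh y z hyz]
        exact le_inf hch (hcb.trans inf_le_right)
  rw [hf.unique hp']
  exact hlub x

/-- The three closure properties of the coherence of an object that currying uses. -/
structure Admissible (γ : Type w) [PartialOrder γ] [HasCoherence γ] : Prop where
  finite_nonempty : ∀ A ∈ coh (α := γ), A.Finite ∧ A.Nonempty
  exists_isGLB : ∀ A ∈ coh (α := γ), ∃ m, IsGLB A m
  pair : ∀ x y : γ, x ≤ y → {x, y} ∈ coh (α := γ)

theorem admissible_of_coherentDIDomain (γ : Type w) [CoherentDIDomain γ] : Admissible γ where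
  finite_nonempty A hA :=
    ⟨CoherentDIDomain.finite_of_coh A hA, CoherentDIDomain.nonempty_of_coh A hA⟩
  exists_isGLB A hA := by
    have hf := CoherentDIDomain.finite_of_coh A hA
    have hn := CoherentDIDomain.nonempty_of_coh A hA
    lift A to Finset γ using hf
    exact ⟨_, Finset.isGLB_inf' (s := A) (Finset.coe_nonempty.1 hn)⟩
  pair x y hxy := by
    refine CoherentDIDomain.coh_of_egliMilner _ (CoherentDIDomain.singleton_coh y) _
      (by simp) (by simp) ?_ ?_
    · rintro _ (rfl | rfl)
      · exact ⟨y, rfl, hxy⟩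
      · exact ⟨_, rfl, le_rfl⟩
    · rintro _ rfl
      exact ⟨x, mem_insert _ _, hxy⟩

theorem Admissible.prod {γ : Type w} {δ : Type v} [PartialOrder γ] [HasCoherence γ]
    [PartialOrder δ] [HasCoherence δ] (hγ : Admissible γ) (hδ : Admissible δ) :
    Admissible (γ × δ) where
  finite_nonempty A hA :=
    ⟨((hγ.finite_nonempty _ hA.1).1.prod (hδ.finite_nonempty _ hA.2).1).subset
      subset_fst_image_prod_snd_image, (hγ.finite_nonempty _ hA.1).2.of_image⟩
  exists_isGLB A hA := by
    obtain ⟨m, hm⟩ := hγ.exists_isGLB _ hA.1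
    obtain ⟨n, hn⟩ := hδ.exists_isGLB _ hA.2
    exact ⟨(m, n), isGLB_prod.2 ⟨hm, hn⟩⟩
  pair x y hxy := by
    refine ⟨?_, ?_⟩
    · rw [image_pair]
      exact hγ.pair _ _ hxy.1
    · rw [image_pair]
      exact hδ.pair _ _ hxy.2

/-- Currying. -/
def curry {γ : Type w} {α : Type u} {β : Type v} [PartialOrder γ] [HasCoherence γ]
    [CoherentDIDomain α] [CoherentDIDomain β] (hγ : Admissible γ)
    (h : StronglyStableMap (γ × α) β) : StronglyStableMap γ (StronglyStableMap α β) where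
  toFun z :=
    { toFun := fun x => h (z, x)
      isStronglyStable := by
        have hz : IsStronglyStable fun x : α => ((z, x) : γ × α) := by
          refine ⟨(ScottContinuous.const z).prodMk ScottContinuous.id, fun A hA => ⟨?_, ?_⟩,
            fun A hA m hm => isGLB_prod.2 ⟨?_, ?_⟩⟩
          · rw [image_image, (CoherentDIDomain.nonempty_of_coh A hA).image_const]
            simpa using hγ.pair z z le_rfl
          · rw [image_image, image_id']
            exact hA
          · rw [image_image, (CoherentDIDomain.nonempty_of_coh A hA).image_const]
            exact isGLB_singleton
          · rw [image_image, image_id']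
            exact hm
        exact h.isStronglyStable.comp hz }
  isStronglyStable := by
    have hα := admissible_of_coherentDIDomain α
    have hx : ∀ x, IsStronglyStable fun z => h (z, x) := by
      intro x
      have hz : IsStronglyStable fun z : γ => ((z, x) : γ × α) := by
        refine ⟨ScottContinuous.id.prodMk (ScottContinuous.const x), fun A hA => ⟨?_, ?_⟩,
          fun A hA m hm => isGLB_prod.2 ⟨?_, ?_⟩⟩
        · rw [image_image, image_id']
          exact hA
        · rw [image_image, (hγ.finite_nonempty A hA).2.image_const]
          exact CoherentDIDomain.singleton_coh x
        · rw [image_image, image_id']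
          exact hm
        · rw [image_image, (hγ.finite_nonempty A hA).2.image_const]
          exact isGLB_singleton
      exact h.isStronglyStable.comp hz
    have hmono : ∀ z z' : γ, z ≤ z' → ∀ x y, x ≤ y → h (z, x) = h (z, y) ⊓ h (z', x) := by
      intro z z' hz x y hxy
      have hc : {(z, y), (z', x)} ∈ coh (α := γ × α) := by
        refine ⟨?_, ?_⟩
        · rw [image_pair]
          exact hγ.pair z z' hz
        · rw [image_pair, pair_comm]
          exact hα.pair x y hxy
      have hg : IsGLB {(z, y), (z', x)} (z, x) := by
        constructor
        · rintro _ (rfl | rfl)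
          · exact ⟨le_rfl, hxy⟩
          · exact ⟨hz, le_rfl⟩
        · intro p hp
          exact ⟨(hp (show (z, y) ∈ _ by simp)).1, (hp (show (z', x) ∈ _ by simp)).2⟩
      have := h.isStronglyStable.map_isGLB _ hc _ hg
      rw [image_pair] at this
      exact this.unique isGLB_pair
    have hglb : ∀ B ∈ coh (α := γ), ∀ m, IsGLB B m → ∀ (e : γ → StronglyStableMap α β),
        (∀ z x, e z x = h (z, x)) → IsGLB (e '' B) (e m) := by
      intro B hB m hm e he
      constructor
      · rintro _ ⟨z, hz, rfl⟩ x y hxy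
        simp only [he]
        exact hmono m z (hm.1 hz) x y hxy
      · intro r hr x y hxy
        have hr' : ∀ z ∈ B, r x = r y ⊓ h (z, x) := fun z hz => by
          rw [← he]
          exact hr ⟨z, hz, rfl⟩ x y hxy
        rw [he]
        refine le_antisymm (le_inf (r.isStronglyStable.monotone hxy)
          (((hx x).map_isGLB B hB m hm).2 ?_)) ?_
        · rintro _ ⟨z, hz, rfl⟩
          exact (hr' z hz).le.trans inf_le_right
        · obtain ⟨z, hz⟩ := (hγ.finite_nonempty B hB).2
          rw [hr' z hz]
          exact inf_le_inf le_rfl ((hx x).monotone (hm.1 hz))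
    refine ⟨fun d hd hd' a ha => ⟨?_, fun g hg x y hxy => ?_⟩, fun B hB => ?_,
      fun B hB m hm => hglb B hB m hm _ fun _ _ => rfl⟩
    · rintro _ ⟨z, hz, rfl⟩
      exact hmono z a (ha.1 hz)
    · have ub : ∀ z ∈ d, ∀ x y, x ≤ y → h (z, x) = h (z, y) ⊓ g x := fun z hz =>
        hg ⟨z, hz, rfl⟩
      change h (a, x) = h (a, y) ⊓ g x
      refine le_antisymm (le_inf (h.isStronglyStable.monotone ⟨le_rfl, hxy⟩)
        (((hx x).scottContinuous hd hd' ha).2 ?_)) ?_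
      · rintro _ ⟨z, hz, rfl⟩
        exact (ub z hz x x le_rfl).le.trans inf_le_right
      · refine DIDomain.le_of_compact fun c hc hcb => ?_
        obtain ⟨z, hz, hcz⟩ := exists_le_of_isLUB_image hc hd
          (DirectedOn.mono_comp (fun _ _ h => (hx y).monotone h) hd')
          ((hx y).scottContinuous hd hd' ha) (hcb.trans inf_le_left)
        refine le_trans ?_ ((hx x).monotone (ha.1 hz))
        rw [ub z hz x y hxy]
        exact le_inf hcz (hcb.trans inf_le_right)
    · obtain ⟨m, hm⟩ := hγ.exists_isGLB B hB
      refine ⟨(hγ.finite_nonempty B hB).1.image _, (hγ.finite_nonempty B hB).2.image _, _,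
        hglb B hB m hm _ fun _ _ => rfl, ?_⟩
      intro A hA M hM₁ hM₂
      set e : γ → StronglyStableMap α β := fun z => ⟨fun x => h (z, x), _⟩ with he
      let N : Set (γ × α) := {p | p.1 ∈ B ∧ (e p.1, p.2) ∈ M}
      have hN₁ : Prod.fst '' N = B := by
        ext z
        constructor
        · rintro ⟨p, hp, rfl⟩
          exact hp.1
        · intro hz
          have : e z ∈ Prod.fst '' M := hM₁ ▸ mem_image_of_mem e hz
          obtain ⟨⟨f, x⟩, hp, hpe⟩ := this
          obtain rfl : f = e z := hpe
          exact ⟨(z, x), ⟨hz, hp⟩, rfl⟩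
      have hN₂ : Prod.snd '' N = A := by
        ext x
        constructor
        · rintro ⟨p, hp, rfl⟩
          rw [← hM₂]
          exact ⟨_, hp.2, rfl⟩
        · intro hxA
          rw [← hM₂] at hxA
          obtain ⟨⟨f, x'⟩, hp, hpe⟩ := hxA
          obtain rfl : x' = x := hpe
          have : f ∈ e '' B := hM₁ ▸ mem_image_of_mem Prod.fst hp
          obtain ⟨z, hz, rfl⟩ := this
          exact ⟨(z, x'), ⟨hz, hp⟩, rfl⟩
      have hval : (fun p : StronglyStableMap α β × α => p.1 p.2) '' M = h '' N := by
        ext b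
        constructor
        · rintro ⟨⟨f, x⟩, hp, rfl⟩
          have : f ∈ e '' B := hM₁ ▸ mem_image_of_mem Prod.fst hp
          obtain ⟨z, hz, rfl⟩ := this
          exact ⟨(z, x), ⟨hz, hp⟩, rfl⟩
        · rintro ⟨⟨z, x⟩, hp, rfl⟩
          exact ⟨(e z, x), hp.2, rfl⟩
      have hN : N ∈ coh (α := γ × α) := ⟨hN₁ ▸ hB, hN₂ ▸ hA⟩
      rw [hval]
      refine ⟨h.isStronglyStable.map_coh N hN, fun a ha => ?_⟩
      exact h.isStronglyStable.map_isGLB N hN (m, a)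
        (isGLB_prod.2 ⟨by rw [hN₁]; exact hm, by rw [hN₂]; exact ha⟩)

/-- Uncurrying. -/
def uncurry {γ : Type w} {α : Type u} {β : Type v} [PartialOrder γ] [HasCoherence γ]
    [CoherentDIDomain α] [CoherentDIDomain β]
    (h : StronglyStableMap γ (StronglyStableMap α β)) : StronglyStableMap (γ × α) β where
  toFun p := h p.1 p.2
  isStronglyStable := by
    have key : ∀ N ∈ coh (α := γ × α), (fun p : γ × α => h p.1 p.2) '' N ∈ coh (α := β) ∧
        ∀ m, IsGLB N m → IsGLB ((fun p : γ × α => h p.1 p.2) '' N) (h m.1 m.2) := by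
      intro N hN
      obtain ⟨-, -, g, hg, hM⟩ := h.isStronglyStable.map_coh _ hN.1
      have := hM _ hN.2 ((fun p : γ × α => (h p.1, p.2)) '' N)
        (by rw [image_image, image_image]; rfl) (by rw [image_image])
      rw [image_image] at this
      refine ⟨this.1, fun m hm => ?_⟩
      have e : h m.1 = g :=
        (h.isStronglyStable.map_isGLB _ hN.1 _ (isGLB_prod.1 hm).1).unique hg
      rw [e]
      exact this.2 _ (isGLB_prod.1 hm).2
    refine ⟨?_, fun N hN => (key N hN).1, fun N hN => (key N hN).2⟩
    refine ScottContinuous.fromProd (fun a => (h a).isStronglyStable.scottContinuous) ?_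
    intro x d hd hd' a ha
    have := isLUB_apply (hd.image h)
      (DirectedOn.mono_comp (fun _ _ hab => h.isStronglyStable.monotone hab) hd')
      (h.isStronglyStable.scottContinuous hd hd' ha) x
    rw [image_image] at this
    exact this

/-- Composition. -/
def comp {γ : Type w} {α : Type u} {β : Type v} [PartialOrder γ] [PartialOrder α]
    [PartialOrder β] [HasCoherence γ] [HasCoherence α] [HasCoherence β]
    (g : StronglyStableMap α β) (f : StronglyStableMap γ α) : StronglyStableMap γ β :=
  ⟨fun x => g (f x), g.isStronglyStable.comp f.isStronglyStable⟩

end StronglyStableMap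

/-- A strongly stable model: a reflexive object `(U, App, Abs)` in the category of dI-domains with
coherence and strongly stable maps. -/
structure StronglyStableModel : Type (u + 1) where
  U : Type u
  [dom : CoherentDIDomain U]
  App : StronglyStableMap U (StronglyStableMap U U)
  Abs : StronglyStableMap (StronglyStableMap U U) U
  app_abs : ∀ f, App (Abs f) = f

namespace StronglyStableModel

attribute [instance] dom

variable (D : StronglyStableModel.{u})

/-- The map `x ↦ λy.x`. -/
def kMap : StronglyStableMap D.U D.U :=
  D.Abs.comp (StronglyStableMap.curry (StronglyStableMap.admissible_of_coherentDIDomain _)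
    ⟨Prod.fst, IsStronglyStable.fst⟩)

/-- The map `((x, y), z) ↦ xz(yz)`. -/
def sMap₃ : StronglyStableMap ((D.U × D.U) × D.U) D.U where
  toFun p := D.App (D.App p.1.1 p.2) (D.App p.1.2 p.2)
  isStronglyStable := by
    have h := (StronglyStableMap.uncurry D.App).isStronglyStable
    have h₁ : IsStronglyStable fun p : (D.U × D.U) × D.U => p.1.1 :=
      IsStronglyStable.fst.comp IsStronglyStable.fst
    have h₂ : IsStronglyStable fun p : (D.U × D.U) × D.U => p.1.2 :=
      IsStronglyStable.snd.comp IsStronglyStable.fst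
    have h₃ : IsStronglyStable fun p : (D.U × D.U) × D.U => p.2 := IsStronglyStable.snd
    exact h.comp ((h.comp (h₁.prodMk h₃)).prodMk (h.comp (h₂.prodMk h₃)))

/-- The map `x ↦ λyz.xz(yz)`. -/
def sMap : StronglyStableMap D.U D.U :=
  D.Abs.comp (StronglyStableMap.curry (StronglyStableMap.admissible_of_coherentDIDomain _)
    (D.Abs.comp (StronglyStableMap.curry
      ((StronglyStableMap.admissible_of_coherentDIDomain _).prod
        (StronglyStableMap.admissible_of_coherentDIDomain _)) D.sMap₃)))

/-- The combinatory algebra underlying the `λ`-model of the points of `U`: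
`x · y = App(x)(y)`, `k = λxy.x` and `s = λxyz.xz(yz)`. -/
def toCombinatoryAlgebra : CombinatoryAlgebra.{u} where
  carrier := D.U
  app x y := D.App x y
  k := D.Abs D.kMap
  s := D.Abs D.sMap
  k_app x y := by
    rw [D.app_abs]
    change D.App (D.Abs _) y = x
    rw [D.app_abs]
    rfl
  s_app x y z := by
    rw [D.app_abs]
    change D.App (D.App (D.Abs _) y) z = _
    rw [D.app_abs]
    change D.App (D.Abs _) z = _
    rw [D.app_abs]
    rfl

end StronglyStableModel

/-! ## `λ`-terms, `λ`-theories and term models -/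

/-- `λ`-terms up to `α`-equivalence, in de Bruijn notation: `var n` below `d` abstractions is bound
if `n < d` and otherwise stands for the free variable `n - d`. -/
inductive LambdaTerm : Type
  | var : ℕ → LambdaTerm
  | app : LambdaTerm → LambdaTerm → LambdaTerm
  | lam : LambdaTerm → LambdaTerm

namespace LambdaTerm

/-- Extend a renaming below an abstraction. -/
def liftRen (ρ : ℕ → ℕ) : ℕ → ℕ
  | 0 => 0
  | n + 1 => ρ n + 1

/-- Renaming of free variables. -/
def rename : (ℕ → ℕ) → LambdaTerm → LambdaTerm
  | ρ, var n => var (ρ n)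
  | ρ, app M N => app (rename ρ M) (rename ρ N)
  | ρ, lam M => lam (rename (liftRen ρ) M)

/-- Extend a substitution below an abstraction. -/
def liftSub (σ : ℕ → LambdaTerm) : ℕ → LambdaTerm
  | 0 => var 0
  | n + 1 => rename Nat.succ (σ n)

/-- Simultaneous capture-avoiding substitution. -/
def subst : (ℕ → LambdaTerm) → LambdaTerm → LambdaTerm
  | σ, var n => σ n
  | σ, app M N => app (subst σ M) (subst σ N)
  | σ, lam M => lam (subst (liftSub σ) M)

/-- The substitution of `N` for the variable `0`, which renumbers the other variables. -/
def single (N : LambdaTerm) : ℕ → LambdaTerm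
  | 0 => N
  | n + 1 => var n

/-- `M[N/x]`, where `x` is the variable bound by `lam M`. -/
def inst (M N : LambdaTerm) : LambdaTerm := subst (single N) M

/-- `β`-conversion. -/
inductive BetaEq : LambdaTerm → LambdaTerm → Prop
  | beta (M N) : BetaEq (app (lam M) N) (inst M N)
  | refl (M) : BetaEq M M
  | symm {M N} : BetaEq M N → BetaEq N M
  | trans {M N P} : BetaEq M N → BetaEq N P → BetaEq M P
  | app {M M' N N'} : BetaEq M M' → BetaEq N N' → BetaEq (app M N) (app M' N')
  | lam {M M'} : BetaEq M M' → BetaEq (lam M) (lam M')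

/-- `lams n M` is `λx₁…xₙ.M`. -/
def lams : ℕ → LambdaTerm → LambdaTerm
  | 0, M => M
  | n + 1, M => lam (lams n M)

/-- `apps M [M₁, …, Mₖ]` is `M M₁ ⋯ Mₖ`. -/
def apps (M : LambdaTerm) (Ms : List LambdaTerm) : LambdaTerm := Ms.foldl app M

/-- A term is solvable if it is `β`-convertible to a head normal form `λx₁…xₙ.y M₁⋯Mₖ`, where the
head `y` is a variable, bound or free. -/
def Solvable (M : LambdaTerm) : Prop :=
  ∃ (n i : ℕ) (Ms : List LambdaTerm), BetaEq M (lams n (apps (var i) Ms))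

theorem subst_rename : ∀ (M : LambdaTerm) (ρ : ℕ → ℕ) (σ τ : ℕ → LambdaTerm),
    (∀ n, σ (ρ n) = τ n) → subst σ (rename ρ M) = subst τ M := by
  intro M
  induction M with
  | var n =>
    intro ρ σ τ h
    exact h n
  | app M N ihM ihN =>
    intro ρ σ τ h
    simp only [rename, subst, ihM ρ σ τ h, ihN ρ σ τ h]
  | lam M ih =>
    intro ρ σ τ h
    simp only [rename, subst]
    rw [ih (liftRen ρ) (liftSub σ) (liftSub τ)]
    rintro (_ | n)
    · rfl
    · simp only [liftRen, liftSub, h n]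

theorem subst_var : ∀ (M : LambdaTerm) (σ : ℕ → LambdaTerm), (∀ n, σ n = var n) →
    subst σ M = M := by
  intro M
  induction M with
  | var n =>
    intro σ h
    exact h n
  | app M N ihM ihN =>
    intro σ h
    simp only [subst, ihM σ h, ihN σ h]
  | lam M ih =>
    intro σ h
    simp only [subst]
    rw [ih (liftSub σ)]
    rintro (_ | n)
    · rfl
    · simp only [liftSub, h n, rename]

theorem inst_rename_succ (M N : LambdaTerm) : subst (single N) (rename Nat.succ M) = M := by
  rw [subst_rename M Nat.succ (single N) var fun _ => rfl]
  exact subst_var M var fun _ => rfl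

theorem inst_rename_succ_two (M N : LambdaTerm) :
    subst (liftSub (single N)) (rename Nat.succ (rename Nat.succ M)) = rename Nat.succ M := by
  rw [subst_rename (rename Nat.succ M) Nat.succ _ (fun n => rename Nat.succ (single N n))
    fun _ => rfl]
  rw [subst_rename M Nat.succ (fun n => rename Nat.succ (single N n)) (fun n => var (n + 1))
    fun _ => rfl]
  rw [← subst_rename M Nat.succ var (fun n => var (n + 1)) fun _ => rfl]
  exact subst_var _ var fun _ => rfl

end LambdaTerm

open LambdaTerm in
/-- A `λ`-theory: a congruence on `λ`-terms that contains `β`-conversion (`α`-equivalent terms are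
identified). -/
structure LambdaTheory where
  rel : LambdaTerm → LambdaTerm → Prop
  equivalence : Equivalence rel
  app_congr : ∀ {M M' N N'}, rel M M' → rel N N' → rel (app M N) (app M' N')
  lam_congr : ∀ {M M'}, rel M M' → rel (lam M) (lam M')
  beta : ∀ M N, rel (app (lam M) N) (inst M N)

namespace LambdaTheory

open LambdaTerm

/-- A `λ`-theory is semi-sensible if it equates no solvable term with an unsolvable one. -/
def SemiSensible (T : LambdaTheory) : Prop :=
  ∀ M N, T.rel M N → Solvable M → Solvable N

/-- Equality in the theory. -/
def setoid (T : LambdaTheory) : Setoid LambdaTerm := ⟨T.rel, T.equivalence⟩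

/-- The combinatory algebra underlying the term model of `T`: the (open) `λ`-terms modulo `T`, with
`k = [λxy.x]` and `s = [λxyz.xz(yz)]`. -/
def termModel (T : LambdaTheory) : CombinatoryAlgebra.{0} where
  carrier := Quotient T.setoid
  app := Quotient.map₂ app fun _ _ h _ _ h' => T.app_congr h h'
  k := Quotient.mk _ (lam (lam (var 1)))
  s := Quotient.mk _
    (lam (lam (lam (app (app (var 2) (var 0)) (app (var 1) (var 0))))))
  k_app x y := by
    induction x using Quotient.inductionOn with | _ M
    induction y using Quotient.inductionOn with | _ N
    refine Quotient.sound ?_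
    have h₁ : T.rel (app (lam (lam (var 1))) M) (lam (rename Nat.succ M)) := T.beta _ _
    have h₂ : T.rel (app (lam (rename Nat.succ M)) N) M := by
      have := T.beta (rename Nat.succ M) N
      rwa [inst, inst_rename_succ] at this
    exact T.equivalence.trans (T.app_congr h₁ (T.equivalence.refl N)) h₂
  s_app x y z := by
    induction x using Quotient.inductionOn with | _ M
    induction y using Quotient.inductionOn with | _ N
    induction z using Quotient.inductionOn with | _ P
    refine Quotient.sound ?_
    have h₁ := T.beta
      (lam (lam (app (app (var 2) (var 0)) (app (var 1) (var 0))))) M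
    have h₂ := T.beta (lam (app (app (rename Nat.succ (rename Nat.succ M)) (var 0))
      (app (var 1) (var 0)))) N
    have h₃ := T.beta (app (app (rename Nat.succ M) (var 0))
      (app (rename Nat.succ N) (var 0))) P
    simp only [inst, subst, single, liftSub, rename, inst_rename_succ,
      inst_rename_succ_two] at h₁ h₂ h₃
    have h₄ := T.app_congr (T.app_congr h₁ (T.equivalence.refl N)) (T.equivalence.refl P)
    have h₅ := T.app_congr h₂ (T.equivalence.refl P)
    exact T.equivalence.trans h₄ (T.equivalence.trans h₅ h₃)

end LambdaTheory

/-!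
An isomorphism of a combinatory algebra with a product `B × C` yields an element `e` for which `exy`
has the first component of `x` and the second component of `y`. Such an `e` is central: it satisfies
`exx = x`, `e(exy)z = exz = ex(eyz)` and `e(xx')(yy') = (exy)(ex'y')`. It remains to see that `exy`
is always `x` or always `y`.

In a model, the step map with the value `c` on an open set `s` and `⊥` elsewhere is representable,
where `s` consists of the elements above a compact `p ≠ ⊥`, or of all elements other than `⊥` in the
continuous case. As this map commutes with `e`, it sends `eq⊥`, where `q ∈ s`, to `ec⊥`. Hence
`ec⊥ = c` for all `c` or `ec⊥ = ⊥` for all `c`, and `e` is a projection.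

In a semi-sensible theory, substitute `Ω` for the free variables of `e`. For a variable `x`, the
term `exx` is still equal to `x`, hence solvable, hence typable in a system of intersection types
that gives no type to `Ω`. So the original `exy` is typable without assumptions on variables other
than `x` and `y`, and by realizability some `exyx⋯x` is convertible to a term with head variable `x`
or `y`. Now substitute for `x` and `y` functions that return `a` and `b` after the appropriate
numbers of arguments. As `e` commutes with application, either `a = ecb` for some `c`, and then
`eab = a`, or `b = eac` for some `c`, and then `eab = b`.
-/

/-! ## Central elements -/

namespace CombinatoryAlgebra

/-- A central element of a combinatory algebra: a homomorphic binary operation `x, y ↦ exy`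
which is a decomposition operation. In a product, `exy` combines the first component of `x` with
the second component of `y`, for a suitable `e`. -/
structure IsCentral (A : CombinatoryAlgebra.{u}) (e : A.carrier) : Prop where
  idem : ∀ x, A.app (A.app e x) x = x
  left : ∀ x y z, A.app (A.app e (A.app (A.app e x) y)) z = A.app (A.app e x) z
  right : ∀ x y z, A.app (A.app e x) (A.app (A.app e y) z) = A.app (A.app e x) z
  map_app : ∀ x x' y y', A.app (A.app e (A.app x x')) (A.app y y') =
    A.app (A.app (A.app e x) y) (A.app (A.app e x') y')

theorem exists_isCentral_of_equiv_prod {A : CombinatoryAlgebra.{u}} {B : CombinatoryAlgebra.{v}}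
    {C : CombinatoryAlgebra.{w}} (φ : A.carrier ≃ B.carrier × C.carrier)
    (hφ : ∀ x y, φ (A.app x y) = (B.app (φ x).1 (φ y).1, C.app (φ x).2 (φ y).2)) :
    ∃ e, A.IsCentral e ∧ ∀ x y, φ (A.app (A.app e x) y) = ((φ x).1, (φ y).2) := by
  have he : ∀ x y, φ (A.app (A.app (φ.symm (B.k, C.app C.k (C.app (C.app C.s C.k) C.k))) x) y) =
      ((φ x).1, (φ y).2) := by
    intro x y
    simp only [hφ, Equiv.apply_symm_apply, B.k_app, C.k_app, C.s_app]
  refine ⟨_, ⟨fun x => ?_, fun x y z => ?_, fun x y z => ?_, fun x x' y y' => ?_⟩, he⟩ <;>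
    exact φ.injective (by simp only [he, hφ, Prod.mk.eta])

theorem directlyIndecomposable_of_isCentral {A : CombinatoryAlgebra.{u}}
    (h : ∀ e, A.IsCentral e →
      (∀ x y, A.app (A.app e x) y = x) ∨ (∀ x y, A.app (A.app e x) y = y)) :
    A.DirectlyIndecomposable := by
  rintro ⟨B, C, ⟨b, b', hb⟩, ⟨c, c', hc⟩, ⟨φ⟩⟩
  let ψ : A.carrier ≃ B.carrier × C.carrier := φ.toEquiv
  obtain ⟨e, he, hψ⟩ := exists_isCentral_of_equiv_prod ψ φ.map_app
  have hbc := hψ (ψ.symm (b, c)) (ψ.symm (b', c'))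
  rcases h e he with h | h <;> simp only [h, Equiv.apply_symm_apply, Prod.mk.injEq] at hbc
  · exact hc hbc.2
  · exact hb hbc.1.symm

theorem directlyIndecomposable_of_nontrivial {A : CombinatoryAlgebra.{u}}
    (h : Nontrivial A.carrier → A.DirectlyIndecomposable) : A.DirectlyIndecomposable := by
  rcases subsingleton_or_nontrivial A.carrier with hA | hA
  · exact directlyIndecomposable_of_isCentral fun _ _ => .inl fun _ _ => Subsingleton.elim _ _
  · exact h hA

end CombinatoryAlgebra

/-! ## Step maps -/

open Classical in
/-- The step map with the value `c` on `s` and the value `b` elsewhere. -/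
noncomputable def stepMap {α : Type u} {β : Type v} (s : Set α) (b c : β) : α → β :=
  s.piecewise (fun _ => c) (fun _ => b)

section StepMap

variable {α : Type u} {β : Type v} {s : Set α} {b c : β}

theorem stepMap_of_mem {x : α} (hx : x ∈ s) : stepMap s b c x = c :=
  if_pos hx

theorem stepMap_of_notMem {x : α} (hx : x ∉ s) : stepMap s b c x = b :=
  if_neg hx

theorem CombinatoryAlgebra.directlyIndecomposable_of_stepMap {A : CombinatoryAlgebra.{u}}
    {s : Set A.carrier} {b : A.carrier} (hb : b ∉ s) (hs : s.Nonempty)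
    (h : ∀ c, ∃ g, A.app g = stepMap s b c) : A.DirectlyIndecomposable := by
  refine directlyIndecomposable_of_isCentral fun e he => ?_
  obtain ⟨q, hq⟩ := hs
  have apply_step : ∀ c, A.app (A.app e c) b = stepMap s b c (A.app (A.app e q) b) := by
    intro c
    obtain ⟨g, hg⟩ := h c
    calc A.app (A.app e c) b
      _ = A.app (A.app e (A.app g q)) (A.app g b) := by
        rw [hg, stepMap_of_mem hq, stepMap_of_notMem hb]
      _ = A.app g (A.app (A.app e q) b) := by rw [he.map_app, he.idem]
      _ = stepMap s b c (A.app (A.app e q) b) := by rw [hg]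
  by_cases hqb : A.app (A.app e q) b ∈ s
  · have left_proj : ∀ c, A.app (A.app e c) b = c := fun c =>
      (apply_step c).trans (stepMap_of_mem hqb)
    refine .inl fun x y => ?_
    calc A.app (A.app e x) y
      _ = A.app (A.app e x) (A.app (A.app e y) b) := by rw [left_proj y]
      _ = x := by rw [he.right, left_proj x]
  · have const : ∀ c, A.app (A.app e c) b = b := fun c =>
      (apply_step c).trans (stepMap_of_notMem hqb)
    refine .inr fun x y => ?_
    calc A.app (A.app e x) y
      _ = A.app (A.app e (A.app (A.app e x) b)) y := (he.left x b y).symm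
      _ = A.app (A.app e (A.app (A.app e y) b)) y := by rw [const x, const y]
      _ = y := by rw [he.left, he.idem]

section PartialOrder

variable [PartialOrder β]

theorem stepMap_le (hbc : b ≤ c) (x : α) : stepMap s b c x ≤ c := by
  by_cases hx : x ∈ s
  · exact (stepMap_of_mem hx).le
  · exact (stepMap_of_notMem hx).trans_le hbc

theorem le_stepMap (hbc : b ≤ c) (x : α) : b ≤ stepMap s b c x := by
  by_cases hx : x ∈ s
  · exact hbc.trans_eq (stepMap_of_mem hx).symm
  · exact (stepMap_of_notMem hx).ge

variable [PartialOrder α]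

theorem scottContinuous_stepMap (hs : IsUpperSet s) (hs' : DirSupInacc s) (hbc : b ≤ c) :
    ScottContinuous (stepMap s b c) := by
  intro d hd hd' a ha
  by_cases has : a ∈ s
  · obtain ⟨x, hxd, hxs⟩ := hs' hd hd' ha has
    rw [stepMap_of_mem has]
    refine IsGreatest.isLUB ⟨⟨x, hxd, stepMap_of_mem hxs⟩, ?_⟩
    rintro _ ⟨y, -, rfl⟩
    exact stepMap_le hbc y
  · have eq_b : ∀ x ∈ d, stepMap s b c x = b := fun x hx =>
      stepMap_of_notMem fun hxs => has (hs (ha.1 hx) hxs)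
    rw [image_congr eq_b, hd.image_const, stepMap_of_notMem has]
    exact isLUB_singleton

theorem dirSupInacc_Ici_of_isCompactElement {p : α} (hp : IsCompactElement p) :
    DirSupInacc (Ici p) :=
  fun _ hd hd' _ ha hpa => hp _ _ hd hd' ha hpa

theorem scottContinuous_stepMap_Ici {p : α} (hp : IsCompactElement p) (hbc : b ≤ c) :
    ScottContinuous (stepMap (Ici p) b c) :=
  scottContinuous_stepMap (isUpperSet_Ici p) (dirSupInacc_Ici_of_isCompactElement hp) hbc

theorem scottContinuous_stepMap_compl_Iic (p : α) (hbc : b ≤ c) :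
    ScottContinuous (stepMap (Iic p)ᶜ b c) :=
  scottContinuous_stepMap (isLowerSet_Iic p).compl
    (dirSupInacc_compl.2 (dirSupClosed_Iic p)) hbc

theorem isGLB_stepMap_Ici_image {p m : α} {A : Set α} (hbc : b ≤ c) (hA : A.Nonempty)
    (hm : IsGLB A m) : IsGLB (stepMap (Ici p) b c '' A) (stepMap (Ici p) b c m) := by
  by_cases hpm : m ∈ Ici p
  · have eq_c : ∀ x ∈ A, stepMap (Ici p) b c x = c := fun x hx =>
      stepMap_of_mem (mem_Ici.1 hpm |>.trans (hm.1 hx))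
    rw [image_congr eq_c, hA.image_const, stepMap_of_mem hpm]
    exact isGLB_singleton
  · obtain ⟨x, hxA, hpx⟩ : ∃ x ∈ A, x ∉ Ici p := by
      by_contra! hall
      exact hpm (hm.2 hall)
    rw [stepMap_of_notMem hpm]
    refine IsLeast.isGLB ⟨⟨x, hxA, stepMap_of_notMem hpx⟩, ?_⟩
    rintro _ ⟨y, -, rfl⟩
    exact le_stepMap hbc y

theorem isStable_stepMap_Ici {p : α} (hp : IsCompactElement p) (hbc : b ≤ c) :
    IsStable (stepMap (Ici p) b c) where
  scottContinuous := scottContinuous_stepMap_Ici hp hbc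
  map_isGLB x y _ _ hm := by
    rw [← image_pair]
    exact isGLB_stepMap_Ici_image hbc (insert_nonempty x {y}) hm

end PartialOrder

theorem CoherentDIDomain.coh_of_finite_of_bddAbove [CoherentDIDomain α] {A : Set α}
    (hfin : A.Finite) (hne : A.Nonempty) (hbdd : BddAbove A) : A ∈ coh (α := α) := by
  obtain ⟨c, hc⟩ := hbdd
  refine coh_of_egliMilner {c} (singleton_coh c) A hfin hne (fun a ha => ⟨c, rfl, hc ha⟩) ?_
  rintro _ rfl
  exact hne.imp fun a ha => ⟨ha, hc ha⟩

theorem isStronglyStable_stepMap_Ici [CoherentDIDomain α] [CoherentDIDomain β] {p : α}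
    (hp : IsCompactElement p) (hbc : b ≤ c) : IsStronglyStable (stepMap (Ici p) b c) where
  scottContinuous := scottContinuous_stepMap_Ici hp hbc
  map_coh A hA := CoherentDIDomain.coh_of_finite_of_bddAbove
    ((CoherentDIDomain.finite_of_coh A hA).image _)
    ((CoherentDIDomain.nonempty_of_coh A hA).image _)
    ⟨c, forall_mem_image.2 fun x _ => stepMap_le hbc x⟩
  map_isGLB A hA _ hm := isGLB_stepMap_Ici_image hbc (CoherentDIDomain.nonempty_of_coh A hA) hm

end StepMap

/-! ## Continuous, stable and strongly stable models -/

theorem ContinuousModel.exists_app_eq (D : ContinuousModel.{u}) {f : D.U → D.U}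
    (hf : ScottContinuous f) : ∃ g, D.toCombinatoryAlgebra.app g = f :=
  ⟨D.Abs ⟨f, hf⟩, congrArg ScottMap.toFun (D.app_abs ⟨f, hf⟩)⟩

theorem StableModel.exists_app_eq (D : StableModel.{u}) {f : D.U → D.U} (hf : IsStable f) :
    ∃ g, D.toCombinatoryAlgebra.app g = f :=
  ⟨D.Abs ⟨f, hf⟩, congrArg StableMap.toFun (D.app_abs ⟨f, hf⟩)⟩

theorem StronglyStableModel.exists_app_eq (D : StronglyStableModel.{u}) {f : D.U → D.U}
    (hf : IsStronglyStable f) : ∃ g, D.toCombinatoryAlgebra.app g = f :=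
  ⟨D.Abs ⟨f, hf⟩, congrArg StronglyStableMap.toFun (D.app_abs ⟨f, hf⟩)⟩

theorem DIDomain.exists_isCompactElement_not_le_bot {α : Type u} [DIDomain α] [Nontrivial α] :
    ∃ p : α, IsCompactElement p ∧ ¬ p ≤ ⊥ := by
  obtain ⟨x, hx⟩ := exists_ne (⊥ : α)
  by_contra! h
  exact hx (le_bot_iff.1 (DIDomain.le_of_compact fun c hc _ => h c hc))

theorem ContinuousModel.directlyIndecomposable (D : ContinuousModel.{u}) :
    D.toCombinatoryAlgebra.DirectlyIndecomposable := by
  refine CombinatoryAlgebra.directlyIndecomposable_of_nontrivial fun (_ : Nontrivial D.U) => ?_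
  obtain ⟨q, hq⟩ := exists_ne (⊥ : D.U)
  have representable (c : D.U) :=
    D.exists_app_eq (scottContinuous_stepMap_compl_Iic ⊥ (bot_le (a := c)))
  exact CombinatoryAlgebra.directlyIndecomposable_of_stepMap (not_not_intro le_rfl)
    ⟨q, mt le_bot_iff.1 hq⟩ representable

theorem StableModel.directlyIndecomposable (D : StableModel.{u}) :
    D.toCombinatoryAlgebra.DirectlyIndecomposable := by
  refine CombinatoryAlgebra.directlyIndecomposable_of_nontrivial fun (_ : Nontrivial D.U) => ?_
  obtain ⟨p, hp, hp'⟩ := DIDomain.exists_isCompactElement_not_le_bot (α := D.U)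
  have representable (c : D.U) :=
    D.exists_app_eq (isStable_stepMap_Ici hp (bot_le (a := c)))
  exact CombinatoryAlgebra.directlyIndecomposable_of_stepMap hp'
    (nonempty_Ici (a := p)) representable

theorem StronglyStableModel.directlyIndecomposable (D : StronglyStableModel.{u}) :
    D.toCombinatoryAlgebra.DirectlyIndecomposable := by
  refine CombinatoryAlgebra.directlyIndecomposable_of_nontrivial fun (_ : Nontrivial D.U) => ?_
  obtain ⟨p, hp, hp'⟩ := DIDomain.exists_isCompactElement_not_le_bot (α := D.U)
  have representable (c : D.U) :=
    D.exists_app_eq (isStronglyStable_stepMap_Ici hp (bot_le (a := c)))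
  exact CombinatoryAlgebra.directlyIndecomposable_of_stepMap hp'
    (nonempty_Ici (a := p)) representable

/-! ## Substitution -/

/-- The sequence `a, f 0, f 1, …`. For substitutions and for environments, it extends `f` by a value
of the variable `0`. -/
def scons {α : Type u} (a : α) (f : ℕ → α) : ℕ → α
  | 0 => a
  | n + 1 => f n

theorem le_scons {α : Type u} [Preorder α] {a : α} {f g : ℕ → α} (h₀ : f 0 ≤ a)
    (h : ∀ n, f (n + 1) ≤ g n) : f ≤ scons a g
  | 0 => h₀
  | n + 1 => h n

theorem scons_mono {α : Type u} [Preorder α] {a b : α} {f g : ℕ → α} (hab : a ≤ b) (hfg : f ≤ g) :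
    scons a f ≤ scons b g :=
  le_scons hab hfg

theorem scons_zero_succ {α : Type u} (f : ℕ → α) : scons (f 0) (fun n => f (n + 1)) = f := by
  funext n
  cases n <;> rfl

namespace LambdaTerm

theorem liftRen_comp (ρ ρ' : ℕ → ℕ) : liftRen (ρ' ∘ ρ) = liftRen ρ' ∘ liftRen ρ := by
  funext n
  cases n <;> rfl

theorem rename_rename (ρ ρ' : ℕ → ℕ) (M : LambdaTerm) :
    rename ρ' (rename ρ M) = rename (ρ' ∘ ρ) M := by
  induction M generalizing ρ ρ' with
  | var n => rfl
  | app M N ihM ihN => simp only [rename, ihM, ihN]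
  | lam M ih => simp only [rename, ih, liftRen_comp]

theorem liftSub_rename_comp (ρ : ℕ → ℕ) (σ : ℕ → LambdaTerm) :
    liftSub (rename ρ ∘ σ) = rename (liftRen ρ) ∘ liftSub σ := by
  funext n
  cases n with
  | zero => rfl
  | succ n =>
    simp only [liftSub, Function.comp_apply, rename_rename]
    rfl

theorem rename_subst (ρ : ℕ → ℕ) (σ : ℕ → LambdaTerm) (M : LambdaTerm) :
    rename ρ (subst σ M) = subst (rename ρ ∘ σ) M := by
  induction M generalizing ρ σ with
  | var n => rfl
  | app M N ihM ihN => simp only [rename, subst, ihM, ihN]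
  | lam M ih => simp only [rename, subst, ih, liftSub_rename_comp]

theorem liftSub_subst_comp (σ σ' : ℕ → LambdaTerm) :
    liftSub (subst σ' ∘ σ) = subst (liftSub σ') ∘ liftSub σ := by
  funext n
  cases n with
  | zero => rfl
  | succ n =>
    simp only [liftSub, Function.comp_apply]
    rw [rename_subst, subst_rename (σ n) Nat.succ (liftSub σ') (rename Nat.succ ∘ σ') fun _ => rfl]

theorem subst_subst (σ σ' : ℕ → LambdaTerm) (M : LambdaTerm) :
    subst σ' (subst σ M) = subst (subst σ' ∘ σ) M := by
  induction M generalizing σ σ' with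
  | var n => rfl
  | app M N ihM ihN => simp only [subst, ihM, ihN]
  | lam M ih => simp only [subst, ih, liftSub_subst_comp]

theorem inst_subst_liftSub (σ : ℕ → LambdaTerm) (M N : LambdaTerm) :
    inst (subst (liftSub σ) M) N = subst (scons N σ) M := by
  rw [inst, subst_subst]
  congr 1
  funext n
  cases n with
  | zero => rfl
  | succ n => exact inst_rename_succ (σ n) N

theorem subst_inst (σ : ℕ → LambdaTerm) (M N : LambdaTerm) :
    subst σ (inst M N) = inst (subst (liftSub σ) M) (subst σ N) := by
  rw [inst_subst_liftSub, inst, subst_subst]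
  congr 1
  funext n
  cases n <;> rfl

theorem subst_apps (σ : ℕ → LambdaTerm) (M : LambdaTerm) (Ms : List LambdaTerm) :
    subst σ (apps M Ms) = apps (subst σ M) (Ms.map (subst σ)) := by
  induction Ms generalizing M with
  | nil => rfl
  | cons N _ ih => exact ih (app M N)

theorem betaEq_app_lam_subst (σ : ℕ → LambdaTerm) (M N : LambdaTerm) :
    BetaEq (app (subst σ (lam M)) N) (subst (scons N σ) M) := by
  rw [← inst_subst_liftSub]
  exact .beta _ _

theorem BetaEq.subst {M N : LambdaTerm} (h : BetaEq M N) (σ : ℕ → LambdaTerm) :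
    BetaEq (M.subst σ) (N.subst σ) := by
  induction h generalizing σ with
  | beta M N =>
    rw [subst_inst]
    exact .beta _ _
  | refl => exact .refl _
  | symm _ ih => exact .symm (ih σ)
  | trans _ _ ih₁ ih₂ => exact .trans (ih₁ σ) (ih₂ σ)
  | app _ _ ih₁ ih₂ => exact .app (ih₁ σ) (ih₂ σ)
  | lam _ ih => exact .lam (ih _)

/-- A strict upper bound for the free variables of a term. -/
def freeBound : LambdaTerm → ℕ
  | var n => n + 1
  | app M N => max (freeBound M) (freeBound N)
  | lam M => freeBound M - 1

theorem subst_congr {M : LambdaTerm} {σ τ : ℕ → LambdaTerm}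
    (h : ∀ n < freeBound M, σ n = τ n) : subst σ M = subst τ M := by
  induction M generalizing σ τ with
  | var n => exact h n n.lt_succ_self
  | app M N ihM ihN =>
    simp only [freeBound, lt_max_iff] at h
    simp only [subst, ihM fun n hn => h n (.inl hn), ihN fun n hn => h n (.inr hn)]
  | lam M ih =>
    simp only [freeBound, Nat.lt_sub_iff_add_lt] at h
    refine congrArg lam (ih fun n hn => ?_)
    cases n with
    | zero => rfl
    | succ n => exact congrArg (rename Nat.succ) (h n hn)

end LambdaTerm

namespace LambdaTheory

open LambdaTerm

variable {T : LambdaTheory}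

theorem rel_of_betaEq {M N : LambdaTerm} (h : BetaEq M N) : T.rel M N := by
  induction h with
  | beta M N => exact T.beta M N
  | refl => exact T.equivalence.refl _
  | symm _ ih => exact T.equivalence.symm ih
  | trans _ _ ih₁ ih₂ => exact T.equivalence.trans ih₁ ih₂
  | app _ _ ih₁ ih₂ => exact T.app_congr ih₁ ih₂
  | lam _ ih => exact T.lam_congr ih

theorem rel_subst_of_freeBound_le {n : ℕ} {M N : LambdaTerm} (hM : freeBound M ≤ n)
    (hN : freeBound N ≤ n) (h : T.rel M N) (σ : ℕ → LambdaTerm) :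
    T.rel (subst σ M) (subst σ N) := by
  induction n generalizing M N σ with
  | zero =>
    have subst_eq_self {P : LambdaTerm} (hP : freeBound P ≤ 0) : subst σ P = P :=
      (subst_congr (τ := var) (by omega)).trans (subst_var P var fun _ => rfl)
    rwa [subst_eq_self hM, subst_eq_self hN]
  | succ n ih =>
    let σ' := fun i => σ (i + 1)
    have lam_rel : T.rel (subst σ' (lam M)) (subst σ' (lam N)) :=
      ih (M := lam M) (N := lam N) (Nat.sub_le_of_le_add hM) (Nat.sub_le_of_le_add hN)
        (T.lam_congr h) σ'
    have beta_rel (P : LambdaTerm) : T.rel (app (subst σ' (lam P)) (σ 0)) (subst σ P) := by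
      have := rel_of_betaEq (T := T) (betaEq_app_lam_subst σ' P (σ 0))
      rwa [scons_zero_succ] at this
    exact T.equivalence.trans (T.equivalence.symm (beta_rel M))
      (T.equivalence.trans (T.app_congr lam_rel (T.equivalence.refl _)) (beta_rel N))

theorem rel_subst {M N : LambdaTerm} (h : T.rel M N) (σ : ℕ → LambdaTerm) :
    T.rel (subst σ M) (subst σ N) :=
  rel_subst_of_freeBound_le (le_max_left _ (freeBound N)) (le_max_right _ _) h σ

end LambdaTheory

/-! ## Intersection types -/

/-- Intersection types: `arrow [A₁, …, Aₙ] B` is `A₁ ∧ ⋯ ∧ Aₙ → B`. -/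
inductive InterType : Type
  | atom : InterType
  | arrow : List InterType → InterType → InterType

namespace LambdaTerm

open InterType

/-- The set of the types of a term in an environment, which gives each free variable a set of types.
This is the interpretation of terms in the graph model of intersection types. -/
def types : LambdaTerm → (ℕ → Set InterType) → Set InterType
  | var n, ρ => ρ n
  | app M N, ρ => {t | ∃ A : List InterType, (∀ a ∈ A, a ∈ types N ρ) ∧ arrow A t ∈ types M ρ}
  | lam M, ρ => {t | ∃ A b, t = arrow A b ∧ b ∈ types M (scons {a | a ∈ A} ρ)}

theorem arrow_mem_types_lam {M : LambdaTerm} {ρ : ℕ → Set InterType} {A : List InterType}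
    {b : InterType} : arrow A b ∈ types (lam M) ρ ↔ b ∈ types M (scons {a | a ∈ A} ρ) := by
  constructor
  · rintro ⟨_, _, ⟨⟩, hb⟩
    exact hb
  · exact fun hb => ⟨A, b, rfl, hb⟩

theorem monotone_types (M : LambdaTerm) : Monotone (types M) := by
  induction M with
  | var n => exact fun _ _ h => h n
  | app M N ihM ihN =>
    rintro ρ ρ' h t ⟨A, hA, ht⟩
    exact ⟨A, fun a ha => ihN h (hA a ha), ihM h ht⟩
  | lam M ih =>
    rintro ρ ρ' h t ⟨A, b, rfl, hb⟩
    exact ⟨A, b, rfl, ih (scons_mono le_rfl h) hb⟩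

theorem exists_finite_le_mem_types {M : LambdaTerm} {ρ : ℕ → Set InterType} {t : InterType}
    (ht : t ∈ types M ρ) : ∃ ρ' ≤ ρ, (∀ n, (ρ' n).Finite) ∧ t ∈ types M ρ' := by
  induction M generalizing ρ t with
  | var n =>
    refine ⟨fun m => {s | s = t ∧ m = n}, ?_,
      fun m => (finite_singleton t).subset fun s => And.left, rfl, rfl⟩
    rintro _ _ ⟨rfl, rfl⟩
    exact ht
  | app M N ihM ihN =>
    obtain ⟨A, hA, ht⟩ := ht
    obtain ⟨ρ₀, hle₀, hfin₀, ht₀⟩ := ihM ht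
    choose! τ hle hfin hτ using fun a ha => ihN (hA a ha)
    have le_biSup {a} (ha : a ∈ A) : τ a ≤ ⨆ a ∈ A, τ a := le_biSup τ ha
    refine ⟨ρ₀ ⊔ ⨆ a ∈ A, τ a, sup_le hle₀ (iSup₂_le hle), fun n => ?_, A, fun a ha => ?_, ?_⟩
    · simp only [Pi.sup_apply, iSup_apply, iSup_eq_iUnion, sup_eq_union]
      exact (hfin₀ n).union (A.finite_toSet.biUnion fun a ha => hfin a ha n)
    · exact monotone_types N ((le_biSup ha).trans le_sup_right) (hτ a ha)
    · exact monotone_types M le_sup_left ht₀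
  | lam M ih =>
    obtain ⟨A, b, rfl, hb⟩ := ht
    obtain ⟨ρ', hle, hfin, hb'⟩ := ih hb
    refine ⟨fun n => ρ' (n + 1), fun n => hle (n + 1), fun n => hfin (n + 1), A, b, rfl,
      monotone_types M ?_ hb'⟩
    exact le_scons (hle 0) fun _ => le_rfl

theorem exists_arrow_mem_types_lam {M : LambdaTerm} {X : Set InterType} {ρ : ℕ → Set InterType}
    {t : InterType} (ht : t ∈ types M (scons X ρ)) :
    ∃ A : List InterType, (∀ a ∈ A, a ∈ X) ∧ arrow A t ∈ types (lam M) ρ := by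
  obtain ⟨ρ', hle, hfin, ht'⟩ := exists_finite_le_mem_types ht
  obtain ⟨A, hA⟩ : ∃ A : List InterType, ∀ a, a ∈ A ↔ a ∈ ρ' 0 :=
    ⟨(hfin 0).toFinset.toList, by simp⟩
  exact ⟨A, fun a ha => hle 0 ((hA a).1 ha), arrow_mem_types_lam.2 <|
    monotone_types M (le_scons (fun a => (hA a).2) fun n => hle (n + 1)) ht'⟩

theorem types_rename (r : ℕ → ℕ) (M : LambdaTerm) (ρ : ℕ → Set InterType) :
    types (rename r M) ρ = types M (ρ ∘ r) := by
  induction M generalizing r ρ with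
  | var n => rfl
  | app M N ihM ihN => simp only [rename, types, ihM, ihN]
  | lam M ih =>
    have scons_comp (X : Set InterType) : scons X ρ ∘ liftRen r = scons X (ρ ∘ r) := by
      funext n
      cases n <;> rfl
    simp only [rename, types, ih, scons_comp]

theorem types_subst (σ : ℕ → LambdaTerm) (M : LambdaTerm) (ρ : ℕ → Set InterType) :
    types (subst σ M) ρ = types M fun n => types (σ n) ρ := by
  induction M generalizing σ ρ with
  | var n => rfl
  | app M N ihM ihN => simp only [subst, types, ihM, ihN]
  | lam M ih =>
    have types_liftSub (X : Set InterType) :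
        (fun n => types (liftSub σ n) (scons X ρ)) = scons X fun n => types (σ n) ρ := by
      funext n
      cases n with
      | zero => rfl
      | succ n => exact types_rename _ _ _
    simp only [subst, types, ih, types_liftSub]

theorem types_inst (M N : LambdaTerm) (ρ : ℕ → Set InterType) :
    types (inst M N) ρ = types M (scons (types N ρ) ρ) := by
  rw [inst, types_subst]
  congr 1
  funext n
  cases n <;> rfl

theorem types_app_lam (M N : LambdaTerm) (ρ : ℕ → Set InterType) :
    types (app (lam M) N) ρ = types M (scons (types N ρ) ρ) := by
  refine Subset.antisymm ?_ fun t ht => exists_arrow_mem_types_lam ht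
  rintro t ⟨A, hA, ht⟩
  exact monotone_types M (scons_mono hA le_rfl) (arrow_mem_types_lam.1 ht)

theorem BetaEq.types_eq {M N : LambdaTerm} (h : BetaEq M N) (ρ : ℕ → Set InterType) :
    M.types ρ = N.types ρ := by
  induction h generalizing ρ with
  | beta M N => rw [types_app_lam, types_inst]
  | refl => rfl
  | symm _ ih => exact (ih ρ).symm
  | trans _ _ ih₁ ih₂ => exact (ih₁ ρ).trans (ih₂ ρ)
  | app _ _ ih₁ ih₂ => simp only [types, ih₁, ih₂]
  | lam _ ih => simp only [types, ih]

theorem types_apps_eq_univ {M : LambdaTerm} {ρ : ℕ → Set InterType} (h : types M ρ = univ)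
    (Ms : List LambdaTerm) : types (apps M Ms) ρ = univ := by
  induction Ms generalizing M with
  | nil => exact h
  | cons N _ ih =>
    refine ih (M := app M N) (eq_univ_of_forall fun t => ⟨[], by simp, ?_⟩)
    rw [h]
    trivial

theorem nonempty_types_lams {M : LambdaTerm} (h : (types M ⊤).Nonempty) (n : ℕ) :
    (types (lams n M) ⊤).Nonempty := by
  induction n with
  | zero => exact h
  | succ n ih =>
    obtain ⟨t, ht⟩ := ih
    rw [← scons_zero_succ ⊤] at ht
    obtain ⟨A, -, hA⟩ := exists_arrow_mem_types_lam ht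
    exact ⟨_, hA⟩

theorem Solvable.nonempty_types {M : LambdaTerm} (h : Solvable M) : (types M ⊤).Nonempty := by
  obtain ⟨n, i, Ms, h⟩ := h
  rw [h.types_eq]
  refine nonempty_types_lams ?_ n
  rw [types_apps_eq_univ rfl]
  exact ⟨atom, trivial⟩

/-- The term `δ = λx.xx`. -/
def delta : LambdaTerm := lam (app (var 0) (var 0))

/-- The unsolvable term `Ω = δδ`. -/
def omega : LambdaTerm := app delta delta

theorem arrow_notMem_types_delta {ρ : ℕ → Set InterType} (A : List InterType) (t : InterType)
    (hA : ∀ a ∈ A, a ∈ types delta ρ) : arrow A t ∉ types delta ρ := by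
  intro ht
  obtain ⟨B, hB, (hBt : arrow B t ∈ A)⟩ := arrow_mem_types_lam.1 ht
  have : sizeOf B < sizeOf A := by
    have := List.sizeOf_lt_of_mem hBt
    simp only [arrow.sizeOf_spec] at this
    omega
  exact arrow_notMem_types_delta B t (fun a ha => hA a (hB a ha)) (hA _ hBt)
termination_by sizeOf A

theorem types_omega (ρ : ℕ → Set InterType) : types omega ρ = ∅ :=
  eq_empty_of_forall_notMem fun t ⟨A, hA, ht⟩ => arrow_notMem_types_delta A t hA ht

end LambdaTerm

/-! ## Realizability -/

namespace LambdaTerm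

open InterType

variable {S : Set ℕ}

/-- The terms `β`-convertible to some `y M₁ ⋯ Mₖ` whose head `y` is a variable in `S`. -/
def headIn (S : Set ℕ) : Set LambdaTerm :=
  {M | ∃ i ∈ S, ∃ Ms, BetaEq M (apps (var i) Ms)}

theorem var_mem_headIn {i : ℕ} (hi : i ∈ S) : var i ∈ headIn S :=
  ⟨i, hi, [], .refl _⟩

theorem app_mem_headIn {M : LambdaTerm} (hM : M ∈ headIn S) (N : LambdaTerm) :
    app M N ∈ headIn S := by
  obtain ⟨i, hi, Ms, hMs⟩ := hM
  refine ⟨i, hi, Ms ++ [N], ?_⟩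
  rw [apps, List.foldl_append]
  exact hMs.app (.refl N)

/-- The realizers of an intersection type, in the logical predicate that interprets `atom` as
`headIn S`. -/
def realizers (S : Set ℕ) : InterType → Set LambdaTerm
  | atom => headIn S
  | arrow A b => {M | ∀ N, (∀ a, a ∈ A → N ∈ realizers S a) → app M N ∈ realizers S b}

theorem mem_realizers_atom {M : LambdaTerm} : M ∈ realizers S atom ↔ M ∈ headIn S := by
  rw [realizers]

theorem mem_realizers_arrow {A : List InterType} {b : InterType} {M : LambdaTerm} :
    M ∈ realizers S (arrow A b) ↔
      ∀ N, (∀ a ∈ A, N ∈ realizers S a) → app M N ∈ realizers S b := by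
  rw [realizers]
  rfl

theorem BetaEq.mem_realizers {M N : LambdaTerm} (h : BetaEq M N) :
    ∀ {t : InterType}, N ∈ realizers S t → M ∈ realizers S t
  | atom, hN => by
    obtain ⟨i, hi, Ms, hMs⟩ := mem_realizers_atom.1 hN
    exact mem_realizers_atom.2 ⟨i, hi, Ms, h.trans hMs⟩
  | arrow _ _, hN => mem_realizers_arrow.2 fun P hP =>
    (h.app (.refl P)).mem_realizers (mem_realizers_arrow.1 hN P hP)

theorem headIn_subset_realizers : ∀ t : InterType, headIn S ⊆ realizers S t
  | atom => fun _ => mem_realizers_atom.2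
  | arrow _ b => fun _ hM => mem_realizers_arrow.2 fun N _ =>
    headIn_subset_realizers b (app_mem_headIn hM N)

theorem exists_apps_replicate_mem_headIn_of_mem_realizers {i : ℕ} (hi : i ∈ S) :
    ∀ {t : InterType} {M : LambdaTerm}, M ∈ realizers S t →
      ∃ k, apps M (List.replicate k (var i)) ∈ headIn S
  | atom, _, hM => ⟨0, mem_realizers_atom.1 hM⟩
  | arrow _ b, _, hM => by
    obtain ⟨k, hk⟩ := exists_apps_replicate_mem_headIn_of_mem_realizers hi (t := b)
      (mem_realizers_arrow.1 hM (var i) fun a _ => headIn_subset_realizers a (var_mem_headIn hi))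
    exact ⟨k + 1, hk⟩

theorem subst_mem_realizers {M : LambdaTerm} {ρ : ℕ → Set InterType} {σ : ℕ → LambdaTerm}
    {t : InterType} (hσ : ∀ n, ∀ a ∈ ρ n, σ n ∈ realizers S a) (ht : t ∈ types M ρ) :
    subst σ M ∈ realizers S t := by
  induction M generalizing ρ σ t with
  | var n => exact hσ n t ht
  | app M N ihM ihN =>
    obtain ⟨A, hA, ht⟩ := ht
    exact mem_realizers_arrow.1 (ihM hσ ht) _ fun a ha => ihN hσ (hA a ha)
  | lam M ih =>
    obtain ⟨A, b, rfl, hb⟩ := ht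
    refine mem_realizers_arrow.2 fun N hN => (betaEq_app_lam_subst σ M N).mem_realizers (ih ?_ hb)
    rintro (_ | n)
    · exact hN
    · exact hσ n

theorem exists_apps_replicate_mem_headIn {M : LambdaTerm} {ρ : ℕ → Set InterType}
    (hρ : ∀ n ∉ S, ρ n = ∅) (hM : (types M ρ).Nonempty) {i : ℕ} (hi : i ∈ S) :
    ∃ k, apps M (List.replicate k (var i)) ∈ headIn S := by
  obtain ⟨t, ht⟩ := hM
  have realize_var (n : ℕ) (a) (ha : a ∈ ρ n) : var n ∈ realizers S a := by
    by_cases hn : n ∈ S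
    · exact headIn_subset_realizers a (var_mem_headIn hn)
    · simp [hρ n hn] at ha
  have hM := subst_mem_realizers realize_var ht
  rw [subst_var M var fun _ => rfl] at hM
  exact exists_apps_replicate_mem_headIn_of_mem_realizers hi hM

end LambdaTerm

/-! ## Central elements of term models -/

namespace CombinatoryAlgebra

variable {A : CombinatoryAlgebra.{u}}

/-- `A.apps x [x₁, …, xₙ]` is `x x₁ ⋯ xₙ`. -/
def apps (A : CombinatoryAlgebra.{u}) (x : A.carrier) (xs : List A.carrier) : A.carrier :=
  xs.foldl A.app x

/-- The element `k(k(⋯(ka)))`, which takes `n` arguments and returns `a`. -/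
def constFun (A : CombinatoryAlgebra.{u}) (a : A.carrier) : ℕ → A.carrier
  | 0 => a
  | n + 1 => A.app A.k (A.constFun a n)

theorem apps_constFun (a : A.carrier) (xs : List A.carrier) :
    A.apps (A.constFun a xs.length) xs = a := by
  induction xs with
  | nil => rfl
  | cons x xs ih =>
    rw [apps, List.length_cons, List.foldl_cons, constFun, A.k_app]
    exact ih

namespace IsCentral

variable {e : A.carrier}

theorem apps (he : A.IsCentral e) (x y : A.carrier) (zs : List A.carrier) :
    A.apps (A.app (A.app e x) y) zs = A.app (A.app e (A.apps x zs)) (A.apps y zs) := by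
  induction zs generalizing x y with
  | nil => rfl
  | cons z zs ih =>
    calc A.apps (A.app (A.app e x) y) (z :: zs)
      _ = A.apps (A.app (A.app e (A.app x z)) (A.app y z)) zs := by
        rw [he.map_app, he.idem]
        rfl
      _ = A.app (A.app e (A.apps x (z :: zs))) (A.apps y (z :: zs)) := ih _ _

theorem app_eq_left (he : A.IsCentral e) {k m : ℕ}
    (h : ∀ x y, ∃ ws zs, ws.length = k ∧ zs.length = m ∧
      A.apps (A.app (A.app e x) y) ws = A.apps x zs) (a b : A.carrier) :
    A.app (A.app e a) b = a := by
  have exists_app_eq : ∀ a, ∃ c, A.app (A.app e c) b = a := by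
    intro a
    obtain ⟨ws, zs, rfl, rfl, hws⟩ := h (A.constFun a m) (A.constFun b k)
    rw [he.apps, apps_constFun, apps_constFun] at hws
    exact ⟨_, hws⟩
  obtain ⟨c, rfl⟩ := exists_app_eq a
  exact he.left c b b

theorem app_eq_right (he : A.IsCentral e) {k m : ℕ}
    (h : ∀ x y, ∃ ws zs, ws.length = k ∧ zs.length = m ∧
      A.apps (A.app (A.app e x) y) ws = A.apps y zs) (a b : A.carrier) :
    A.app (A.app e a) b = b := by
  have exists_app_eq : ∀ b, ∃ c, A.app (A.app e a) c = b := by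
    intro b
    obtain ⟨ws, zs, rfl, rfl, hws⟩ := h (A.constFun a k) (A.constFun b m)
    rw [he.apps, apps_constFun, apps_constFun] at hws
    exact ⟨_, hws⟩
  obtain ⟨c, rfl⟩ := exists_app_eq b
  exact he.right a a c

end IsCentral

end CombinatoryAlgebra

namespace LambdaTheory

open LambdaTerm

variable {T : LambdaTheory}

theorem rel_app_subst_omega {e : LambdaTerm} (he : ∀ N, T.rel (app (app e N) N) N)
    (N : LambdaTerm) : T.rel (app (app (subst (fun _ => omega) e) N) N) N := by
  let σ : ℕ → LambdaTerm := fun n => if n = freeBound e then N else omega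
  have subst_e : subst σ e = subst (fun _ => omega) e :=
    subst_congr fun n hn => if_neg hn.ne
  have subst_fresh : σ (freeBound e) = N := if_pos rfl
  have := rel_subst (he (var (freeBound e))) σ
  simpa only [subst, subst_e, subst_fresh] using this

theorem SemiSensible.nonempty_types (hT : T.SemiSensible) {e : LambdaTerm}
    (he : ∀ N, T.rel (app (app e N) N) N) :
    (types (app (app (rename (· + 2) e) (var 0)) (var 1))
      (scons univ (scons univ ⊥))).Nonempty := by
  have var_solvable : Solvable (var 0) := ⟨0, 0, [], .refl _⟩
  have solvable : Solvable (app (app (subst (fun _ => omega) e) (var 0)) (var 0)) :=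
    hT _ _ (T.equivalence.symm (rel_app_subst_omega he (var 0))) var_solvable
  have types_e : types (subst (fun _ => omega) e) ⊤ =
      types (rename (· + 2) e) (scons univ (scons univ ⊥)) := by
    simp only [types_subst, types_omega, types_rename]
    rfl
  have := solvable.nonempty_types
  simp only [types, types_e] at this
  exact this

theorem SemiSensible.exists_betaEq_apps (hT : T.SemiSensible) {e : LambdaTerm}
    (he : ∀ N, T.rel (app (app e N) N) N) :
    ∃ k, ∃ i ∈ ({0, 1} : Set ℕ), ∃ m, ∀ X Y, ∃ Ms : List LambdaTerm, Ms.length = m ∧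
      BetaEq (apps (app (app e X) Y) (List.replicate k X)) (apps (scons X (scons Y var) i) Ms) := by
  have empty_off : ∀ n ∉ ({0, 1} : Set ℕ), scons univ (scons univ ⊥) n = (∅ : Set InterType)
    | 0, h => absurd (.inl rfl) h
    | 1, h => absurd (.inr rfl) h
    | n + 2, _ => rfl
  obtain ⟨k, i, hi, Ms, hMs⟩ :=
    exists_apps_replicate_mem_headIn empty_off (hT.nonempty_types he) (.inl rfl)
  refine ⟨k, i, hi, Ms.length, fun X Y =>
    ⟨Ms.map (subst (scons X (scons Y var))), List.length_map _, ?_⟩⟩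
  have subst_e : subst (scons X (scons Y var)) (rename (· + 2) e) = e :=
    (subst_rename e (· + 2) (scons X (scons Y var)) var fun _ => rfl).trans
      (subst_var e var fun _ => rfl)
  have := hMs.subst (scons X (scons Y var))
  simp only [subst_apps, List.map_replicate, subst, subst_e] at this
  exact this

/-- The class of a term in the term model. -/
def toTermModel (T : LambdaTheory) (M : LambdaTerm) : T.termModel.carrier :=
  Quotient.mk T.setoid M

theorem toTermModel_surjective : Function.Surjective T.toTermModel :=
  Quotient.mk_surjective

theorem toTermModel_eq_iff {M N : LambdaTerm} :
    T.toTermModel M = T.toTermModel N ↔ T.rel M N :=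
  Quotient.eq (r := T.setoid)

theorem toTermModel_apps (M : LambdaTerm) (Ms : List LambdaTerm) :
    T.toTermModel (apps M Ms) = T.termModel.apps (T.toTermModel M) (Ms.map T.toTermModel) := by
  induction Ms generalizing M with
  | nil => rfl
  | cons N _ ih => exact ih (app M N)

theorem SemiSensible.directlyIndecomposable_termModel (hT : T.SemiSensible) :
    T.termModel.DirectlyIndecomposable := by
  refine CombinatoryAlgebra.directlyIndecomposable_of_isCentral fun e he => ?_
  obtain ⟨e, rfl⟩ := toTermModel_surjective e
  obtain ⟨k, i, hi, m, h⟩ := hT.exists_betaEq_apps fun N =>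
    toTermModel_eq_iff.1 (he.idem (T.toTermModel N))
  have apps_eq (X Y : LambdaTerm) : ∃ ws zs, ws.length = k ∧ zs.length = m ∧
      T.termModel.apps (T.toTermModel (app (app e X) Y)) ws =
        T.termModel.apps (T.toTermModel (scons X (scons Y var) i)) zs := by
    obtain ⟨Ms, hm, hMs⟩ := h X Y
    have := toTermModel_eq_iff.2 (rel_of_betaEq (T := T) hMs)
    rw [toTermModel_apps, toTermModel_apps] at this
    exact ⟨_, _, by simp, by simpa, this⟩
  rcases hi with rfl | rfl
  · exact .inl (he.app_eq_left (toTermModel_surjective.forall₂.2 apps_eq))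
  · exact .inr (he.app_eq_right (toTermModel_surjective.forall₂.2 apps_eq))

end LambdaTheory

theorem mainTheorem7 :
    (∀ D : ContinuousModel.{u}, D.toCombinatoryAlgebra.DirectlyIndecomposable) ∧
    (∀ D : StableModel.{u}, D.toCombinatoryAlgebra.DirectlyIndecomposable) ∧
    (∀ D : StronglyStableModel.{u}, D.toCombinatoryAlgebra.DirectlyIndecomposable) ∧
    (∀ T : LambdaTheory, T.SemiSensible → T.termModel.DirectlyIndecomposable) :=
  ⟨ContinuousModel.directlyIndecomposable, StableModel.directlyIndecomposable,
    StronglyStableModel.directlyIndecomposable, fun _ hT => hT.directlyIndecomposable_termModel⟩
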